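/- **Setting.** Let $2\le k<\frac n2$ be integers, and let $(\mathbb H^n,b)$, $b=dr^2+\sinh^2 r\,d\Theta^2$, be hyperbolic space, $r$ being the distance to a fixed point $x_0$. Put $V=V_{(0)}=\cosh r$ and $V_{(i)}=\theta^i\sinh r$ ($i=1,\dots,n$, with $\theta\in\mathbb S^{n-1}$ the angular variable). Bars denote quantities of $b$, and repeated indices are summed. For a Riemannian metric $g$ with curvature tensor $R_{ijsl}$ (positive sectional curvature corresponding to $R_{ijij}>0$) let $$\tilde R_{ijsl}=R_{ijsl}+g_{is}g_{jl}-g_{il}g_{js},\qquad \tilde L_k=\frac1{2^k}\,\delta^{i_1\cdots i_{2k}}_{j_1\cdots j_{2k}}\,\tilde R_{i_1i_2}{}^{j_1j_2}\cdots\tilde R_{i_{2k-1}i_{2k}}{}^{j_{2k-1}j_{2k}},$$ $$\tilde P_{(k)}^{stjl}=\frac1{2^k}\,\delta^{i_1\cdots i_{2k-2}st}_{j_1\cdots j_{2k-2}pq}\,\tilde R_{i_1i_2}{}^{j_1j_2}\cdots\tilde R_{i_{2k-3}i_{2k-2}}{}^{j_{2k-3}j_{2k-2}}\,g^{pj}g^{ql},$$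 where $\delta^{\cdots}_{\cdots}$ is the generalized Kronecker delta (the determinant of the matrix of ordinary Kronecker deltas). A metric $g$ on $\mathbb H^n$ is called asymptotically hyperbolic of decay order $\tau$ (with the identity as chart at infinity) if, outside some closed ball, $g$ and $b$ are uniformly equivalent, and $$\|g-b\|_b+\|\bar\nabla g\|_b+\|\bar\nabla^2g\|_b=O(e^{-\tau r}).$$ With $e=g-b$, $S_r$ the geodesic sphere of radius $r$ about $x_0$, $\nu$ its outward $b$-unit normal and $d\mu$ its area element induced by $b$, put $$H_k(W)=\lim_{r\to\infty}\int_{S_r}\big(W\bar\nabla_l e_{js}-e_{js}\bar\nabla_l W\big)\tilde P_{(k)}^{ijsl}\,\nu_i\,d\mu$$ for $W\in\mathbb N_b=\{W\in C^\infty(\mathbb H^n):\mathrm{Hess}^bW=Wb\}=\mathrm{span}\{V_{(0)},\dots,V_{(n)}\}$. Let $\eta$ be the Lorentz inner product on $\mathbb N_b$ for which the $V_{(i)}$ are orthogonal, $\eta(V_{(0)},V_{(0)})=1$ and $\eta(V_{(i)},V_{(i)})=-1$ for $i\ge1$; let $\mathbb N_b^1=\{W\in\mathbb N_b: W>0,\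 \eta(W,W)=1\}$. The Gauss–Bonnet–Chern mass is $$m_k^{\mathbb H}=c(n,k)\inf_{W\in\mathbb N_b^1}H_k(W),\qquad c(n,k)=\frac{(n-2k)!}{2^{k-1}(n-1)!\,\omega_{n-1}},\qquad \omega_{n-1}=|\mathbb S^{n-1}|.$$ **Theorem (Positive Mass Theorem for graphs).** Let $f:\mathbb H^n\to\mathbb R$ be smooth, and suppose that $g=b+V^2\,df\otimes df$ is asymptotically hyperbolic of decay order $\tau>\frac n{k+1}$ and that $V\tilde L_k$ is integrable with respect to $dV_g$. Then $\frac{V\tilde L_k}{\sqrt{1+V^2|\bar\nabla f|^2}}$ is integrable with respect to $dV_g$, the limit $H_k(V)$ exists, and $$c(n,k)\,H_k(V)=c(n,k)\int_{\mathbb H^n}\frac12\,\frac{V\tilde L_k}{\sqrt{1+V^2|\bar\nabla f|^2}}\,dV_g .$$ In particular, $\tilde L_k\ge0$ implies $c(n,k)H_k(V)\ge0$. Consequently, if the infimum defining the mass is attained at $V=V_{(0)}$, i.e. $H_k(V)\le H_k(W)$ for all $W\in\mathbb N_b^1$, then $$m_k^{\mathbb H}=c(n,k)\int_{\mathbb H^n}\frac12\,\frac{V\tilde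 L_k}{\sqrt{1+V^2|\bar\nabla f|^2}}\,dV_g,$$ and $\tilde L_k\ge0$ implies $m_k^{\mathbb H}\ge0$. -/

import Mathlib

open scoped ContDiff
open MeasureTheory Filter Topology

noncomputable section

namespace GBCMass

/-! Hyperbolic space `ℍⁿ` is the upper sheet `{(√(1+|x|²), x)}` of the hyperboloid in Minkowski space,
described in its global chart `x ∈ ℝⁿ`. Tensor fields are written in components in this chart. -/

/-- The chart domain of the global chart of `ℍⁿ`. The base point `x₀` is the origin. -/
abbrev E (n : ℕ) : Type := EuclideanSpace ℝ (Fin n)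

/-- Metric components `g_{ij}` (or those of any 2-tensor) as a function of the point. -/
abbrev Metric2 (n : ℕ) : Type := E n → Matrix (Fin n) (Fin n) ℝ

/-- Covariant `m`-tensor fields in components. -/
abbrev CovTensor (n m : ℕ) : Type := E n → (Fin m → Fin n) → ℝ

/-- The partial derivative `∂_i F`. -/
def pd {n : ℕ} (i : Fin n) (F : E n → ℝ) (x : E n) : ℝ :=
  fderiv ℝ F x (EuclideanSpace.single i 1)

/-- The hyperbolic distance `r` to the base point; `|x| = sinh r`. -/
def hypDist {n : ℕ} (x : E n) : ℝ := Real.arsinh ‖x‖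

/-- `V₍₀₎ = cosh r`. -/
def V0 {n : ℕ} (x : E n) : ℝ := Real.cosh (hypDist x)

/-- The hyperbolic metric `b`: the pull back of the Minkowski metric `-dt² + |dx|²` by
`x ↦ (√(1+|x|²), x)`. In polar coordinates `x = sinh r • θ` it is `dr² + sinh² r dΘ²`. -/
def hypMetric (n : ℕ) : Metric2 n := fun x =>
  Matrix.of fun i j => (if i = j then 1 else 0) - x i * x j / (1 + ‖x‖ ^ 2)

/-- The Riemannian volume measure `√(det g) dx`. -/
def volMeasure {n : ℕ} (g : Metric2 n) : Measure (E n) :=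
  (volume : Measure (E n)).withDensity fun x => ENNReal.ofReal (Real.sqrt (g x).det)

/-- Christoffel symbols `Γ^s_{ij}` of `g`. -/
def christoffel {n : ℕ} (g : Metric2 n) (x : E n) (s i j : Fin n) : ℝ :=
  (1 / 2) * ∑ l, (g x)⁻¹ s l *
    (pd i (fun y => g y j l) x + pd j (fun y => g y i l) x - pd l (fun y => g y i j) x)

/-- The components `R_{ij}{}^t{}_l` of the curvature: `R(∂_i, ∂_j) ∂_l = R_{ij}{}^t{}_l ∂_t`. -/
def riemUp {n : ℕ} (g : Metric2 n) (x : E n) (i j t l : Fin n) : ℝ :=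
  pd i (fun y => christoffel g y t j l) x - pd j (fun y => christoffel g y t i l) x
    + ∑ m, (christoffel g x t i m * christoffel g x m j l
      - christoffel g x t j m * christoffel g x m i l)

/-- `R_{ijsl} = g_{st} R_{ij}{}^t{}_l`; the sign is such that `R_{ijij} > 0` on round spheres. -/
def riem {n : ℕ} (g : Metric2 n) (x : E n) (i j s l : Fin n) : ℝ :=
  ∑ t, g x s t * riemUp g x i j t l

/-- The modified curvature `R̃_{ijsl} = R_{ijsl} + g_{is} g_{jl} - g_{il} g_{js}`. -/
def riemMod {n : ℕ} (g : Metric2 n) (x : E n) (i j s l : Fin n) : ℝ :=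
  riem g x i j s l + g x i s * g x j l - g x i l * g x j s

/-- `R̃_{ij}{}^{sl}`. -/
def riemModUp {n : ℕ} (g : Metric2 n) (x : E n) (i j s l : Fin n) : ℝ :=
  ∑ p, ∑ q, (g x)⁻¹ s p * (g x)⁻¹ l q * riemMod g x i j p q

/-- The generalized Kronecker delta `δ^I_J`, the determinant of the matrix of Kronecker deltas. -/
def genDelta {ι : Type} [Fintype ι] [DecidableEq ι] {n : ℕ} (I J : ι → Fin n) : ℝ :=
  Matrix.det (Matrix.of fun a c => if I a = J c then (1 : ℝ) else 0)

/-- The modified Gauss-Bonnet curvature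
`L̃_k = 2^{-k} δ^{i₁…i₂ₖ}_{j₁…j₂ₖ} R̃_{i₁i₂}{}^{j₁j₂} ⋯ R̃_{i₂ₖ₋₁i₂ₖ}{}^{j₂ₖ₋₁j₂ₖ}`;
the index `i_{2a+1}` is `I (a, 0)` and `i_{2a+2}` is `I (a, 1)`. -/
def gbCurv {n : ℕ} (k : ℕ) (g : Metric2 n) (x : E n) : ℝ :=
  (1 / 2 ^ k) * ∑ I : Fin k × Fin 2 → Fin n, ∑ J : Fin k × Fin 2 → Fin n,
    genDelta I J * ∏ a : Fin k, riemModUp g x (I (a, 0)) (I (a, 1)) (J (a, 0)) (J (a, 1))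

/-- The tensor `P̃_{(k)}^{stjl} = 2^{-k} δ^{i₁…i₂ₖ₋₂ s t}_{j₁…j₂ₖ₋₂ p q}
R̃_{i₁i₂}{}^{j₁j₂} ⋯ R̃_{i₂ₖ₋₃i₂ₖ₋₂}{}^{j₂ₖ₋₃j₂ₖ₋₂} g^{pj} g^{ql}`, for `k ≥ 1`. -/
def gbP {n : ℕ} (k : ℕ) (g : Metric2 n) (x : E n) (s t j l : Fin n) : ℝ :=
  (1 / 2 ^ k) * ∑ I : Fin (k - 1) × Fin 2 → Fin n, ∑ J : Fin (k - 1) × Fin 2 → Fin n,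
    ∑ p : Fin n, ∑ q : Fin n,
      genDelta (Sum.elim I ![s, t]) (Sum.elim J ![p, q])
        * (∏ a : Fin (k - 1), riemModUp g x (I (a, 0)) (I (a, 1)) (J (a, 0)) (J (a, 1)))
        * (g x)⁻¹ p j * (g x)⁻¹ q l

/-- Covariant derivative with respect to `g` of a covariant tensor field; the new index is the
first one: `(∇T)_{l i₁…iₘ} = ∇_l T_{i₁…iₘ}`. -/
def covDeriv {n m : ℕ} (g : Metric2 n) (T : CovTensor n m) : CovTensor n (m + 1) := fun x I =>
  pd (I 0) (fun y => T y (Fin.tail I)) x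
    - ∑ a : Fin m, ∑ p : Fin n,
        christoffel g x p (I 0) (I a.succ) * T x (Function.update (Fin.tail I) a p)

/-- The pointwise norm `‖T‖_g` of a covariant tensor field. -/
def tensorNorm {n m : ℕ} (g : Metric2 n) (T : CovTensor n m) (x : E n) : ℝ :=
  Real.sqrt (∑ I : Fin m → Fin n, ∑ J : Fin m → Fin n,
    (∏ a, (g x)⁻¹ (I a) (J a)) * T x I * T x J)

/-- A function as a `0`-tensor. -/
def scalarTensor {n : ℕ} (W : E n → ℝ) : CovTensor n 0 := fun x _ => W x

/-- A field of bilinear forms as a `2`-tensor. -/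
def twoTensor {n : ℕ} (g : Metric2 n) : CovTensor n 2 := fun x I => g x (I 0) (I 1)

/-- The value `g_x(v, v)`. -/
def quadForm {n : ℕ} (g : Metric2 n) (x v : E n) : ℝ := ∑ i, ∑ j, g x i j * v i * v j

/-- The metric `g` on `ℍⁿ` is asymptotically hyperbolic of decay order `τ`, with the identity of
`ℍⁿ` as diffeomorphism at infinity: outside a closed ball `g` and `b` are uniformly equivalent, and
`‖g - b‖_b + ‖∇̄ g‖_b + ‖∇̄² g‖_b = O(e^{-τ r})` as `r → ∞`. -/
structure IsAsymptoticallyHyperbolic {n : ℕ} (g : Metric2 n) (τ : ℝ) : Prop where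
  equiv : ∃ ρ Λ : ℝ, 0 < Λ ∧ ∀ x : E n, ρ < hypDist x → ∀ v : E n,
    Λ⁻¹ * quadForm (hypMetric n) x v ≤ quadForm g x v ∧
      quadForm g x v ≤ Λ * quadForm (hypMetric n) x v
  decay : (fun x : E n =>
      tensorNorm (hypMetric n) (twoTensor (g - hypMetric n)) x
      + tensorNorm (hypMetric n) (covDeriv (hypMetric n) (twoTensor g)) x
      + tensorNorm (hypMetric n) (covDeriv (hypMetric n) (covDeriv (hypMetric n) (twoTensor g))) x)
    =O[Bornology.cobounded (E n)] fun x => Real.exp (-τ * hypDist x)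

/-- `ℕ_b = {W ∈ C^∞(ℍⁿ) | Hess^b W = W b}`. -/
def staticPotentials (n : ℕ) : Set (E n → ℝ) :=
  {W | ContDiff ℝ ∞ W ∧ ∀ (x : E n) (i j : Fin n),
    covDeriv (hypMetric n) (covDeriv (hypMetric n) (scalarTensor W)) x ![i, j]
      = W x * hypMetric n x i j}

/-- The Lorentz inner product `η` on `ℕ_b`, expressed by values and gradients at the base point.
`ℕ_b` is spanned by `V₍₀₎ = cosh r` (value `1`, gradient `0` at the base point) and the coordinate
functions `V₍ᵢ₎ = x^i = θ^i sinh r` (value `0`, gradient `e_i`), so this is the bilinear form for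
which these functions are orthogonal with `η(V₍₀₎, V₍₀₎) = 1` and `η(V₍ᵢ₎, V₍ᵢ₎) = -1`. -/
def eta {n : ℕ} (W W' : E n → ℝ) : ℝ := W 0 * W' 0 - ∑ i, pd i W 0 * pd i W' 0

/-- `ℕ_b^1`: the positive elements `W` of `ℕ_b` with `η(W, W) = 1`. -/
def unitPotentials (n : ℕ) : Set (E n → ℝ) :=
  {W | W ∈ staticPotentials n ∧ (∀ x, 0 < W x) ∧ eta W W = 1}

/-- The components `ν_i = ∂_i r` of the outward unit conormal of the geodesic spheres around the
base point. -/
def conormal {n : ℕ} (x : E n) (i : Fin n) : ℝ := x i / (‖x‖ * Real.sqrt (1 + ‖x‖ ^ 2))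

/-- The density `(W ∇̄_l e_{js} - e_{js} ∇̄_l W) P̃_{(k)}^{ijsl} ν_i`, where `e = g - b`. -/
def massDensity {n : ℕ} (k : ℕ) (g : Metric2 n) (W : E n → ℝ) (x : E n) : ℝ :=
  ∑ i, ∑ j, ∑ s, ∑ l,
    (W x * covDeriv (hypMetric n) (twoTensor (g - hypMetric n)) x ![l, j, s]
        - (g - hypMetric n) x j s * pd l W x)
      * gbP k g x i j s l * conormal x i

/-- The integral of the mass density over the geodesic sphere `S_r` around the base point. `S_r` is
parametrized by the unit sphere via `θ ↦ sinh r • θ`, and its area element induced by `b` is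
`sinh^{n-1} r dΘ`. -/
def massFlux {n : ℕ} (k : ℕ) (g : Metric2 n) (W : E n → ℝ) (r : ℝ) : ℝ :=
  ∫ θ : Metric.sphere (0 : E n) 1,
    massDensity k g W (Real.sinh r • (θ : E n)) * Real.sinh r ^ (n - 1)
    ∂(volume : Measure (E n)).toSphere

/-- The mass functional `H_k(W) = lim_{r → ∞} ∫_{S_r} …`. -/
def massFunctional {n : ℕ} (k : ℕ) (g : Metric2 n) (W : E n → ℝ) : ℝ :=
  limUnder atTop (massFlux k g W)

/-- The area `ω_{n-1}` of the unit sphere of `ℝⁿ`. -/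
def sphereArea (n : ℕ) : ℝ := (volume : Measure (E n)).toSphere.real Set.univ

/-- `c(n,k) = (n-2k)! / (2^{k-1} (n-1)! ω_{n-1})`. -/
def massConst (n k : ℕ) : ℝ :=
  (n - 2 * k).factorial / (2 ^ (k - 1) * (n - 1).factorial * sphereArea n)

/-- The Gauss-Bonnet-Chern mass `m_k^ℍ = c(n,k) inf_{W ∈ ℕ_b^1} H_k(W)`. -/
def gbcMass {n : ℕ} (k : ℕ) (g : Metric2 n) : ℝ :=
  massConst n k * sInf (massFunctional k g '' unitPotentials n)

/-- `|∇̄ f|²`, the squared norm of the gradient with respect to `b`. -/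
def gradSq {n : ℕ} (f : E n → ℝ) (x : E n) : ℝ :=
  ∑ i, ∑ j, (hypMetric n x)⁻¹ i j * pd i f x * pd j f x

/-- The metric `b + V² df ⊗ df` of the graph of `f` in `(ℍⁿ × ℝ, b + V² ds ⊗ ds)`,
`V = cosh r`. -/
def graphMetric {n : ℕ} (f : E n → ℝ) : Metric2 n := fun x =>
  hypMetric n x + Matrix.of fun i j => V0 x ^ 2 * pd i f x * pd j f x

/-- The integrand `½ V L̃_k / √(1 + V² |∇̄ f|²)` for the graph of `f`. -/
def massIntegrand {n : ℕ} (k : ℕ) (f : E n → ℝ) (x : E n) : ℝ :=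
  (1 / 2) * (V0 x * gbCurv k (graphMetric f) x) / Real.sqrt (1 + V0 x ^ 2 * gradSq f x)

end GBCMass

end

/-! Write `V = cosh r` and `W = √(1 + V²|∇̄f|²)`. The warped product `b + V² ds²` on `ℍⁿ × ℝ` is
hyperbolic space of dimension `n + 1`: the map `(x, s) ↦ (x, V cosh s, V sinh s)` is an isometry
onto a sheet of the hyperboloid in Minkowski space, under which `∂_s` becomes the infinitesimal
boost of the last two coordinates. So `g` is the induced metric of a hypersurface of hyperbolic
space, with shape operator `A` and unit normal `N`.

By the Gauss equation `R̃` consists of the 2 × 2 minors of `A`. Hence `L̃_k` is `newtonS (2k) A`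
(`gbCurv_eq_newtonS`), and contracting `P̃` with the second fundamental form gives half the Newton
tensor `T` of order `2k - 1` (`gbP_contraction`). By the Codazzi equation `T` is divergence free
(`newtonT_divergence`). Along the graph `∂_s = ξ + (V/W) N` with `ξ` tangent, and Killing's equation
says that the symmetric part of `∇ξ` is `(V/W) A`. Therefore `div (Tξ) = (V/W) tr(TA) = (V/W) L̃_k`.
In the chart `√det g = W/V`, so the Euclidean divergence of `Y = ½ √det g Tξ` is exactly `½ L̃_k`
(`graphFlux_divergence`).

On the other side, up to terms that the antisymmetry of `P̃` kills, the coefficient in the mass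
density is `V² W ∂_s f h_{jl}`, `h` being the second fundamental form. The mass density is thus the
Euclidean normal component of `Y` (`massDensity_graph`). As `S_r` is the coordinate sphere of radius
`sinh r`, the divergence theorem gives an exact identity at every `r > 0`: the flux is the integral
of `½ L̃_k dx` over the ball (`massFlux_graph`).

Finally `½ (V L̃_k / W) dV_g = ½ L̃_k dx`, while `V L̃_k dV_g = W L̃_k dx` with `W ≥ 1`.
Integrability of the latter gives that of the former, and `r → ∞` yields the formula and the sign.
For the infimum it remains that `V` itself belongs to `ℕ_b^1`. -/

noncomputable section

namespace GBCMass

/-! ### Calculus of partial derivatives in the chart. -/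

section PartialDerivatives

variable {n : ℕ}

theorem pd_add {F G : E n → ℝ} {x : E n} (i : Fin n) (hF : DifferentiableAt ℝ F x)
    (hG : DifferentiableAt ℝ G x) : pd i (fun y => F y + G y) x = pd i F x + pd i G x := by
  simp [pd, fderiv_fun_add hF hG]

theorem pd_sub {F G : E n → ℝ} {x : E n} (i : Fin n) (hF : DifferentiableAt ℝ F x)
    (hG : DifferentiableAt ℝ G x) : pd i (fun y => F y - G y) x = pd i F x - pd i G x := by
  simp [pd, fderiv_fun_sub hF hG]

theorem pd_mul {F G : E n → ℝ} {x : E n} (i : Fin n) (hF : DifferentiableAt ℝ F x)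
    (hG : DifferentiableAt ℝ G x) :
    pd i (fun y => F y * G y) x = pd i F x * G x + F x * pd i G x := by
  simp [pd, fderiv_fun_mul hF hG]; ring

theorem pd_sum {κ : Type*} {s : Finset κ} {F : κ → E n → ℝ} {x : E n} (i : Fin n)
    (hF : ∀ a ∈ s, DifferentiableAt ℝ (F a) x) :
    pd i (fun y => ∑ a ∈ s, F a y) x = ∑ a ∈ s, pd i (F a) x := by
  simp [pd, fderiv_fun_sum hF]

theorem pd_const (c : ℝ) (i : Fin n) (x : E n) : pd i (fun _ => c) x = 0 := by
  simp [pd]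

theorem pd_comp {φ : ℝ → ℝ} {φ' : ℝ} {F : E n → ℝ} {x : E n} (i : Fin n)
    (hφ : HasDerivAt φ φ' (F x)) (hF : DifferentiableAt ℝ F x) :
    pd i (fun y => φ (F y)) x = φ' * pd i F x := by
  have := (hφ.comp_hasFDerivAt x hF.hasFDerivAt).fderiv
  simp only [pd]
  rw [show (fun y => φ (F y)) = φ ∘ F from rfl, this]
  simp

theorem differentiableAt_prod {κ : Type*} {s : Finset κ} {F : κ → E n → ℝ} {x : E n}
    (hF : ∀ a ∈ s, DifferentiableAt ℝ (F a) x) :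
    DifferentiableAt ℝ (fun y => ∏ a ∈ s, F a y) x := by
  classical
  have := (HasFDerivAt.finsetProd (u := s) (g := F)
    (fun a ha => (hF a ha).hasFDerivAt)).differentiableAt
  convert this using 1

theorem pd_prod {κ : Type*} [DecidableEq κ] {s : Finset κ} {F : κ → E n → ℝ} {x : E n} (i : Fin n)
    (hF : ∀ a ∈ s, DifferentiableAt ℝ (F a) x) :
    pd i (fun y => ∏ a ∈ s, F a y) x = ∑ a ∈ s, (∏ b ∈ s.erase a, F b x) * pd i (F a) x := by
  have := (HasFDerivAt.finsetProd (u := s) (g := F)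
    (fun a ha => (hF a ha).hasFDerivAt)).fderiv
  simp [pd, this]

theorem pd_coord (i j : Fin n) (x : E n) : pd i (fun y => y j) x = if i = j then 1 else 0 := by
  have : (fun y : E n => y j) = (EuclideanSpace.proj j : E n →L[ℝ] ℝ) := rfl
  simp only [pd]
  rw [this, ContinuousLinearMap.fderiv]
  simp [eq_comm]

theorem contDiff_coord (j : Fin n) : ContDiff ℝ ∞ (fun y : E n => y j) :=
  (EuclideanSpace.proj j : E n →L[ℝ] ℝ).contDiff

theorem contDiff_pd {F : E n → ℝ} (hF : ContDiff ℝ ∞ F) (i : Fin n) : ContDiff ℝ ∞ (pd i F) := by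
  have : ContDiff ℝ ∞ (fderiv ℝ F) := hF.fderiv_right (by simp)
  exact this.clm_apply contDiff_const

theorem smooth_differentiableAt {F : E n → ℝ} (hF : ContDiff ℝ ∞ F) {x : E n} :
    DifferentiableAt ℝ F x :=
  hF.differentiable (by simp) x

theorem pd_comm {F : E n → ℝ} (hF : ContDiff ℝ ∞ F) (i j : Fin n) (x : E n) :
    pd i (pd j F) x = pd j (pd i F) x := by
  have h1 : ContDiff ℝ ∞ (fderiv ℝ F) := hF.fderiv_right (by simp)
  have hd : DifferentiableAt ℝ (fderiv ℝ F) x := h1.differentiable (by simp) x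
  have hs : IsSymmSndFDerivAt ℝ F x :=
    (hF.contDiffAt (x := x)).isSymmSndFDerivAt (by rw [minSmoothness_of_isRCLikeNormedField]; exact WithTop.coe_le_coe.2 le_top)
  have key : ∀ a b : Fin n, pd a (pd b F) x =
      fderiv ℝ (fderiv ℝ F) x (EuclideanSpace.single a 1) (EuclideanSpace.single b 1) := by
    intro a b
    change fderiv ℝ (fun y => fderiv ℝ F y (EuclideanSpace.single b 1)) x _ = _
    rw [fderiv_clm_apply hd (by fun_prop)]
    simp
  rw [key, key]
  exact hs _ _

/-- Jacobi's formula. Differentiating one factor of the Leibniz expansion replaces one column, and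
Cramer's rule turns the resulting determinants into the adjugate. -/
theorem pd_matrix_det {A : E n → Matrix (Fin n) (Fin n) ℝ} {x : E n} (m : Fin n)
    (hA : ∀ i j, DifferentiableAt ℝ (fun y => A y i j) x) :
    pd m (fun y => (A y).det) x =
      ((A x).adjugate * Matrix.of fun i j => pd m (fun y => A y i j) x).trace := by
  have h1 : ∀ y, (A y).det = ∑ σ : Equiv.Perm (Fin n),
      ((Equiv.Perm.sign σ : ℤ) : ℝ) * ∏ i, A y (σ i) i := fun y => Matrix.det_apply' _
  simp_rw [h1]
  rw [pd_sum m (fun σ _ => by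
    refine DifferentiableAt.const_mul ?_ _
    refine differentiableAt_prod fun i _ => hA _ _)]
  have h2 : ∀ σ : Equiv.Perm (Fin n), pd m (fun y => ((Equiv.Perm.sign σ : ℤ) : ℝ) *
      ∏ i, A y (σ i) i) x = ∑ i, ((Equiv.Perm.sign σ : ℤ) : ℝ) *
      ∏ j, (A x).updateCol i (fun a => pd m (fun y => A y a i) x) (σ j) j := by
    intro σ
    rw [pd_mul m (by fun_prop) (differentiableAt_prod fun i _ => hA _ _), pd_const,
      pd_prod (F := fun i y => A y (σ i) i) m (fun i _ => hA _ _), zero_mul, zero_add, Finset.mul_sum]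
    refine Finset.sum_congr rfl fun i _ => ?_
    congr 1
    rw [← Finset.mul_prod_erase _ _ (Finset.mem_univ i), mul_comm]
    congr 1
    · simp
    · refine Finset.prod_congr rfl fun j hj => ?_
      rw [Matrix.updateCol_ne (Finset.ne_of_mem_erase hj)]
  simp_rw [h2]
  rw [Finset.sum_comm]
  simp_rw [← Matrix.det_apply', ← Matrix.cramer_apply, Matrix.cramer_eq_adjugate_mulVec]
  simp [Matrix.trace, Matrix.mul_apply, Matrix.mulVec, dotProduct]

end PartialDerivatives

/-! ### Mixed discriminants and the algebra of Newton tensors. -/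

section MixedDiscriminant

variable {n : ℕ} {ι κ : Type} [Fintype ι] [DecidableEq ι] [Fintype κ] [DecidableEq κ]

theorem genDelta_comp_equiv (e : ι ≃ κ) (I J : κ → Fin n) :
    genDelta (I ∘ e) (J ∘ e) = genDelta I J :=
  Matrix.det_submatrix_equiv_self e (Matrix.of fun a c => if I a = J c then (1 : ℝ) else 0)

theorem genDelta_comp_perm_right (σ : Equiv.Perm ι) (I J : ι → Fin n) :
    genDelta I (J ∘ σ) = ((Equiv.Perm.sign σ : ℤ) : ℝ) * genDelta I J :=
  Matrix.det_permute' σ (Matrix.of fun a c => if I a = J c then (1 : ℝ) else 0)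

/-- The mixed discriminant `δ^I_J ∏ₐ (Bₐ)^{Jₐ}_{Iₐ}`, where a matrix `B` has the entries
`B^p_i = B p i`. -/
def mixedDisc (B : ι → Matrix (Fin n) (Fin n) ℝ) : ℝ :=
  ∑ I : ι → Fin n, ∑ J : ι → Fin n, genDelta I J * ∏ a, B a (J a) (I a)

/-- Relabelling both index tuples leaves the generalized delta unchanged. Mixed discriminants are
therefore symmetric in their slots and may be indexed by any finite type, such as `Fin k × Fin 2`.
-/
theorem mixedDisc_comp_equiv (e : ι ≃ κ) (B : κ → Matrix (Fin n) (Fin n) ℝ) :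
    mixedDisc (B ∘ e) = mixedDisc B := by
  simp only [mixedDisc]
  rw [← (Equiv.arrowCongr e (Equiv.refl (Fin n))).symm.sum_comp]
  refine Finset.sum_congr rfl fun I _ => ?_
  rw [← (Equiv.arrowCongr e (Equiv.refl (Fin n))).symm.sum_comp]
  refine Finset.sum_congr rfl fun J _ => ?_
  have h : ∀ K : κ → Fin n, (Equiv.arrowCongr e (Equiv.refl (Fin n))).symm K = K ∘ e := fun K => by
    ext; simp [Equiv.arrowCongr]
  rw [h, h, genDelta_comp_equiv]
  congr 1
  exact e.prod_comp (fun a => B a (J a) (I a))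

theorem mixedDisc_update (B : ι → Matrix (Fin n) (Fin n) ℝ) (a : ι) (M : Matrix (Fin n) (Fin n) ℝ) :
    mixedDisc (Function.update B a M) = ∑ I : ι → Fin n, ∑ J : ι → Fin n,
      genDelta I J * (M (J a) (I a) * ∏ b ∈ Finset.univ.erase a, B b (J b) (I b)) := by
  simp only [mixedDisc]
  refine Finset.sum_congr rfl fun I _ => Finset.sum_congr rfl fun J _ => ?_
  rw [← Finset.mul_prod_erase _ _ (Finset.mem_univ a)]
  simp only [Function.update_self]
  congr 2
  refine Finset.prod_congr rfl fun b hb => ?_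
  rw [Function.update_of_ne (Finset.ne_of_mem_erase hb)]

/-- The linear dependence of the mixed discriminant on one of its arguments. -/
def mixedDiscLin (B : ι → Matrix (Fin n) (Fin n) ℝ) (a : ι) : Matrix (Fin n) (Fin n) ℝ →ₗ[ℝ] ℝ where
  toFun M := mixedDisc (Function.update B a M)
  map_add' M N := by
    simp only [mixedDisc_update, ← Finset.sum_add_distrib, Matrix.add_apply]
    refine Finset.sum_congr rfl fun I _ => Finset.sum_congr rfl fun J _ => by ring
  map_smul' c M := by
    simp only [mixedDisc_update, Matrix.smul_apply, smul_eq_mul, RingHom.id_apply, Finset.mul_sum]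
    refine Finset.sum_congr rfl fun I _ => Finset.sum_congr rfl fun J _ => by ring

/-- The generalized Newton tensor `T^i_p = δ^{i I}_{p J} ∏ₐ A^{Jₐ}_{Iₐ}` of order `m`. -/
def newtonT (m : ℕ) (A : Matrix (Fin n) (Fin n) ℝ) : Matrix (Fin n) (Fin n) ℝ :=
  Matrix.of fun i p => mixedDisc (Fin.cons (Matrix.single p i 1) fun _ : Fin m => A)

/-- `S = δ^I_J ∏ₐ A^{Jₐ}_{Iₐ}`, that is `m!` times the elementary symmetric function. -/
def newtonS (m : ℕ) (A : Matrix (Fin n) (Fin n) ℝ) : ℝ := mixedDisc fun _ : Fin m => A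

/-- Linearity in the first slot: expand `B` in elementary matrices, on which the entries of
`newtonT` are defined. -/
theorem mixedDisc_cons (m : ℕ) (A B : Matrix (Fin n) (Fin n) ℝ) :
    mixedDisc (Fin.cons B fun _ : Fin m => A) = (newtonT m A * B).trace := by
  have h : ∀ M : Matrix (Fin n) (Fin n) ℝ, mixedDisc (Fin.cons M fun _ : Fin m => A) =
      mixedDiscLin (fun _ : Fin (m + 1) => A) 0 M := fun M => by
    simp only [mixedDiscLin, LinearMap.coe_mk, AddHom.coe_mk]
    congr 1
    funext a
    refine Fin.cases ?_ (fun a => ?_) a <;> simp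
  simp only [newtonT, h, Matrix.trace, Matrix.diag, Matrix.mul_apply, Matrix.of_apply]
  conv_lhs => rw [Matrix.matrix_eq_sum_single B]
  simp only [map_sum]
  rw [Finset.sum_comm]
  refine Finset.sum_congr rfl fun i _ => Finset.sum_congr rfl fun p _ => ?_
  rw [show Matrix.single p i (B p i) = B p i • Matrix.single p i (1 : ℝ) by simp, map_smul,
    smul_eq_mul, mul_comm]

theorem mixedDisc_update_const (m : ℕ) (A B : Matrix (Fin n) (Fin n) ℝ) (a : Fin (m + 1)) :
    mixedDisc (Function.update (fun _ : Fin (m + 1) => A) a B) = (newtonT m A * B).trace := by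
  rw [← mixedDisc_cons, ← mixedDisc_comp_equiv (Equiv.swap 0 a)]
  congr 1
  funext b
  refine Fin.cases ?_ (fun c => ?_) b
  · simp
  · simp only [Function.comp, Fin.cons_succ]
    rw [Function.update_of_ne]
    intro h
    have := (Equiv.swap (0 : Fin (m + 1)) a).injective (h.trans (Equiv.swap_apply_left 0 a).symm)
    exact Fin.succ_ne_zero _ this

theorem newtonS_succ (m : ℕ) (A : Matrix (Fin n) (Fin n) ℝ) :
    newtonS (m + 1) A = (newtonT m A * A).trace := by
  rw [← mixedDisc_cons, newtonS]
  congr 1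
  funext b
  refine Fin.cases ?_ (fun c => ?_) b <;> simp

theorem newtonT_zero (A : Matrix (Fin n) (Fin n) ℝ) : newtonT 0 A = 1 := by
  ext i p
  simp only [newtonT, Matrix.of_apply, mixedDisc]
  rw [← (Equiv.funUnique (Fin 1) (Fin n)).symm.sum_comp]
  simp_rw [← (Equiv.funUnique (Fin 1) (Fin n)).symm.sum_comp (fun J : Fin 1 → Fin n => _)]
  simp [genDelta, Matrix.single_apply, Matrix.one_apply, ite_and]

theorem det_updateRow_zero_single_zero {m : ℕ} (M : Matrix (Fin (m + 1)) (Fin (m + 1)) ℝ) :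
    (M.updateRow 0 (Pi.single 0 1)).det = (M.submatrix Fin.succ Fin.succ).det := by
  rw [Matrix.det_succ_row_zero, Fin.sum_univ_succ, Finset.sum_eq_zero]
  · simp only [Fin.val_zero, pow_zero, Matrix.updateRow_self, Pi.single_eq_same, one_mul, add_zero]
    congr 1
  · intro c _
    simp

/-- Laplace expansion of the generalized Kronecker delta along its first upper index. -/
theorem genDelta_cons (m : ℕ) (i p : Fin n) (I J : Fin m → Fin n) :
    genDelta (Fin.cons i I : Fin (m + 1) → Fin n) (Fin.cons p J) =
      (if i = p then genDelta I J else 0)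
        - ∑ a, if i = J a then genDelta I (Function.update J a p) else 0 := by
  rw [genDelta, Matrix.det_eq_sum_mul_adjugate_row _ 0, Fin.sum_univ_succ, sub_eq_add_neg,
    ← Finset.sum_neg_distrib]
  simp only [Matrix.adjugate_apply]
  congr 1
  · rw [det_updateRow_zero_single_zero]
    simp only [Matrix.of_apply, Fin.cons_zero, ite_mul, one_mul, zero_mul]
    rfl
  · refine Finset.sum_congr rfl fun a _ => ?_
    -- The cofactor of column `a.succ`: exchanging that column with column `0` costs a sign and puts
    -- `p` in the place of `J a`.
    have h := Matrix.det_permute' (Equiv.swap 0 a.succ)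
      ((Matrix.of fun b c => if (Fin.cons i I : Fin (m + 1) → Fin n) b =
        (Fin.cons p J : Fin (m + 1) → Fin n) c then (1 : ℝ) else 0).updateRow 0
          (Pi.single a.succ 1))
    rw [Equiv.Perm.sign_swap (Fin.succ_ne_zero a).symm] at h
    have h2 : ((Matrix.of fun b c => if (Fin.cons i I : Fin (m + 1) → Fin n) b =
        (Fin.cons p J : Fin (m + 1) → Fin n) c then (1 : ℝ) else 0).updateRow 0
          (Pi.single a.succ 1)).submatrix id (Equiv.swap 0 a.succ) =
        (Matrix.of fun b c => if (Fin.cons i I : Fin (m + 1) → Fin n) b =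
        (Fin.cons (J a) (Function.update J a p) : Fin (m + 1) → Fin n) c
          then (1 : ℝ) else 0).updateRow 0 (Pi.single 0 1) := by
      have hswap : ∀ c, (Fin.cons p J : Fin (m + 1) → Fin n) (Equiv.swap 0 a.succ c) =
          (Fin.cons (J a) (Function.update J a p) : Fin (m + 1) → Fin n) c := by
        intro c
        refine Fin.cases ?_ (fun d => ?_) c
        · simp
        · by_cases hd : d = a
          · subst hd; simp
          · rw [Equiv.swap_apply_of_ne_of_ne (Fin.succ_ne_zero d) (by simpa using hd)]
            simp [hd]
      ext b c
      refine Fin.cases ?_ (fun b' => ?_) b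
      · simp only [Matrix.submatrix_apply, id, Matrix.updateRow_self, Pi.single_apply]
        simp [Equiv.swap_apply_eq_iff]
      · simp only [Matrix.submatrix_apply, id, Matrix.updateRow_ne (Fin.succ_ne_zero b'),
          Matrix.of_apply, hswap]
    rw [h2, det_updateRow_zero_single_zero] at h
    have h3 : genDelta I (Function.update J a p) = -((Matrix.of fun b c =>
        if (Fin.cons i I : Fin (m + 1) → Fin n) b =
        (Fin.cons p J : Fin (m + 1) → Fin n) c then (1 : ℝ) else 0).updateRow 0
          (Pi.single a.succ 1)).det := by
      rw [← neg_one_mul]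
      refine Eq.trans ?_ (h.trans (by simp))
      rfl
    rw [h3]
    simp only [Matrix.of_apply, Fin.cons_zero, Fin.cons_succ]
    split_ifs <;> simp

theorem mixedDisc_fin_succ (m : ℕ) (B : Matrix (Fin n) (Fin n) ℝ)
    (A : Fin m → Matrix (Fin n) (Fin n) ℝ) :
    mixedDisc (Fin.cons B A : Fin (m + 1) → Matrix (Fin n) (Fin n) ℝ) =
      ∑ I : Fin m → Fin n, ∑ J : Fin m → Fin n, ∑ i, ∑ p,
        genDelta (Fin.cons i I : Fin (m + 1) → Fin n) (Fin.cons p J)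
          * (B p i * ∏ a, A a (J a) (I a)) := by
  simp only [mixedDisc]
  rw [← (Fin.consEquiv fun _ : Fin (m + 1) => Fin n).sum_comp, Fintype.sum_prod_type_right]
  refine Finset.sum_congr rfl fun I _ => ?_
  simp_rw [← (Fin.consEquiv fun _ : Fin (m + 1) => Fin n).sum_comp (fun J => _),
    Fintype.sum_prod_type_right]
  rw [Finset.sum_comm]
  refine Finset.sum_congr rfl fun J _ => Finset.sum_congr rfl fun i _ =>
    Finset.sum_congr rfl fun p _ => ?_
  simp [Fin.consEquiv, Fin.prod_univ_succ]

/-- Laplace expansion of the delta along the upper index of `B`. The diagonal term closes `B` to a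
trace; every other term glues `B` to one of the factors `A`. -/
theorem mixedDisc_cons_expand (m : ℕ) (A B : Matrix (Fin n) (Fin n) ℝ) :
    mixedDisc (Fin.cons B fun _ : Fin m => A) = B.trace * newtonS m A
      - ∑ a, mixedDisc (Function.update (fun _ : Fin m => A) a (B * A)) := by
  rw [mixedDisc_fin_succ]
  simp only [genDelta_cons, sub_mul, Finset.sum_sub_distrib]
  congr 1
  · simp only [newtonS, mixedDisc, Finset.mul_sum, ite_mul, zero_mul]
    refine Finset.sum_congr rfl fun I _ => Finset.sum_congr rfl fun J _ => ?_
    simp only [Finset.sum_ite_eq, Finset.mem_univ, if_true, Matrix.trace, Matrix.diag,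
      Finset.sum_mul]
    refine Finset.sum_congr rfl fun i _ => by ring
  · simp_rw [mixedDisc_update]
    conv_rhs => rw [Finset.sum_comm]
    refine Finset.sum_congr rfl fun I _ => ?_
    simp only [Finset.sum_mul]
    trans ∑ J : Fin m → Fin n, ∑ a, ∑ p, genDelta I (Function.update J a p) *
          (B p (J a) * ∏ b, A (J b) (I b))
    · refine Finset.sum_congr rfl fun J _ => ?_
      rw [Finset.sum_comm]
      conv_rhs => rw [Finset.sum_comm]
      refine Finset.sum_congr rfl fun p _ => ?_
      rw [Finset.sum_comm]
      refine Finset.sum_congr rfl fun a _ => ?_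
      simp [ite_mul]
    · rw [Finset.sum_comm]
      refine Finset.sum_congr rfl fun a _ => ?_
      simp only [Matrix.mul_apply, Finset.mul_sum, Finset.sum_mul]
      rw [← Fintype.sum_prod_type', ← Fintype.sum_prod_type']
      -- Exchanging the free index with the `a`-th entry of `J` makes the updated tuple the new
      -- summation variable.
      have hinv : Function.Involutive fun z : (Fin m → Fin n) × Fin n =>
          (Function.update z.1 a z.2, z.1 a) := fun z => by simp
      rw [← Equiv.sum_comp hinv.toPerm]
      refine Finset.sum_congr rfl fun z _ => ?_
      simp only [Function.Involutive.coe_toPerm, Function.update_self, Function.update_idem,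
        Function.update_eq_self]
      rw [← Finset.mul_prod_erase _ _ (Finset.mem_univ a), Function.update_self,
        Finset.prod_congr rfl fun b hb => by
          rw [Function.update_of_ne (Finset.ne_of_mem_erase hb)]]
      ring

/-- The classical recursion, without the usual division by factorials; `m + 1` counts the slots into
which the elementary matrix can be glued. -/
theorem newtonT_succ (m : ℕ) (A : Matrix (Fin n) (Fin n) ℝ) :
    newtonT (m + 1) A = newtonS (m + 1) A • 1 - ((m : ℝ) + 1) • (A * newtonT m A) := by
  ext i p
  simp only [newtonT, Matrix.of_apply]
  rw [mixedDisc_cons_expand]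
  simp only [mixedDisc_update_const, Finset.sum_const, Finset.card_univ, Fintype.card_fin]
  rw [← Matrix.mul_assoc, Matrix.trace_mul_comm, ← Matrix.mul_assoc]
  have h : ∀ M : Matrix (Fin n) (Fin n) ℝ, (M * Matrix.single p i 1).trace = M i p := fun M => by
    simp [Matrix.trace_mul_single]
  rw [h]
  simp [Matrix.trace, Matrix.single_apply, Matrix.one_apply, newtonT, ite_and]

theorem newtonT_commute (m : ℕ) (A : Matrix (Fin n) (Fin n) ℝ) :
    A * newtonT m A = newtonT m A * A := by
  induction m with
  | zero => simp [newtonT_zero]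
  | succ m ih =>
    rw [newtonT_succ, mul_sub, sub_mul, mul_smul_comm, mul_smul_comm, smul_mul_assoc,
      smul_mul_assoc, mul_one, one_mul, ih, ← mul_assoc, ih]

/-- If `A` is self adjoint with respect to `G`, then so are its Newton tensors. -/
theorem newtonT_mul_transpose (m : ℕ) {A G : Matrix (Fin n) (Fin n) ℝ} (hG : G.transpose = G)
    (h : (A * G).transpose = A * G) : (newtonT m A * G).transpose = newtonT m A * G := by
  have hA : G * A.transpose = A * G := by rwa [Matrix.transpose_mul, hG] at h
  induction m with
  | zero => simp [newtonT_zero, hG]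
  | succ m ih =>
    have ih' : G * (newtonT m A).transpose = newtonT m A * G := by
      rwa [Matrix.transpose_mul, hG] at ih
    rw [newtonT_succ, sub_mul, Matrix.transpose_sub, smul_mul_assoc, smul_mul_assoc, one_mul,
      Matrix.transpose_smul, Matrix.transpose_smul, hG, Matrix.transpose_mul,
      Matrix.transpose_mul, hG, ← mul_assoc, ih', mul_assoc, hA, ← mul_assoc, ← newtonT_commute]

/-- The componentwise partial derivative of a matrix field. -/
def pdM (i : Fin n) (A : E n → Matrix (Fin n) (Fin n) ℝ) (x : E n) : Matrix (Fin n) (Fin n) ℝ :=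
  Matrix.of fun a b => pd i (fun y => A y a b) x

/-- Product rule; by symmetry all `m + 1` slots contribute the same trace. -/
theorem pd_newtonS {A : E n → Matrix (Fin n) (Fin n) ℝ} {x : E n} (i : Fin n) (m : ℕ)
    (hA : ∀ a b, DifferentiableAt ℝ (fun y => A y a b) x) :
    pd i (fun y => newtonS (m + 1) (A y)) x = (m + 1) * (newtonT m (A x) * pdM i A x).trace := by
  have h : ∑ a, mixedDisc (Function.update (fun _ : Fin (m + 1) => A x) a (pdM i A x)) =
      (m + 1) * (newtonT m (A x) * pdM i A x).trace := by
    simp [mixedDisc_update_const]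
  rw [← h]
  simp_rw [mixedDisc_update]
  simp only [newtonS, mixedDisc]
  have hprod : ∀ I J : Fin (m + 1) → Fin n,
      DifferentiableAt ℝ (fun y => ∏ a, A y (J a) (I a)) x :=
    fun I J => differentiableAt_prod fun a _ => hA _ _
  rw [pd_sum i fun I _ => DifferentiableAt.fun_sum fun J _ => (hprod I J).const_mul _,
    Finset.sum_comm]
  refine Finset.sum_congr rfl fun I _ => ?_
  rw [pd_sum i fun J _ => (hprod I J).const_mul _, Finset.sum_comm]
  refine Finset.sum_congr rfl fun J _ => ?_
  rw [pd_mul i (by fun_prop) (hprod I J), pd_const, pd_prod i fun a _ => hA _ _, zero_mul,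
    zero_add, Finset.mul_sum]
  refine Finset.sum_congr rfl fun a _ => ?_
  rw [mul_comm (pdM i A x _ _)]
  rfl

theorem contDiff_mixedDisc {B : E n → ι → Matrix (Fin n) (Fin n) ℝ}
    (hB : ∀ a p i, ContDiff ℝ ∞ fun y => B y a p i) : ContDiff ℝ ∞ fun y => mixedDisc (B y) := by
  unfold mixedDisc
  exact ContDiff.sum fun I _ => ContDiff.sum fun J _ => contDiff_const.mul
    (contDiff_prod fun a _ => hB _ _ _)

theorem contDiff_newtonS {A : E n → Matrix (Fin n) (Fin n) ℝ} (m : ℕ)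
    (hA : ∀ a b, ContDiff ℝ ∞ fun y => A y a b) : ContDiff ℝ ∞ fun y => newtonS m (A y) :=
  contDiff_mixedDisc fun _ => hA

theorem contDiff_newtonT {A : E n → Matrix (Fin n) (Fin n) ℝ} (m : ℕ)
    (hA : ∀ a b, ContDiff ℝ ∞ fun y => A y a b) (i p : Fin n) :
    ContDiff ℝ ∞ fun y => newtonT m (A y) i p := by
  refine contDiff_mixedDisc (B := fun y => Fin.cons (Matrix.single p i 1) fun _ : Fin m => A y)
    fun a => ?_
  refine Fin.cases ?_ (fun _ => ?_) a
  · intro q j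
    simpa using contDiff_const
  · simpa using hA

end MixedDiscriminant

/-! ### Divergence of Newton tensors and of their fluxes. -/

section NewtonDivergence

variable {n : ℕ}

theorem pdM_mul {A B : E n → Matrix (Fin n) (Fin n) ℝ} {x : E n} (i : Fin n)
    (hA : ∀ a b, DifferentiableAt ℝ (fun y => A y a b) x)
    (hB : ∀ a b, DifferentiableAt ℝ (fun y => B y a b) x) :
    pdM i (fun y => A y * B y) x = pdM i A x * B x + A x * pdM i B x := by
  ext a b
  simp only [pdM, Matrix.of_apply, Matrix.mul_apply, Matrix.add_apply, ← Finset.sum_add_distrib]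
  rw [pd_sum i fun c _ => (hA _ _).fun_mul (hB _ _)]
  exact Finset.sum_congr rfl fun c _ => pd_mul i (hA _ _) (hB _ _)

/-- The covariant derivative in direction `i` of the `(1,1)`-tensor `A^a_b = A a b`, for the
connection with the coefficients `Γ^a_{ib} = Γ i a b`. -/
def covM (Γ : Fin n → Matrix (Fin n) (Fin n) ℝ) (i : Fin n)
    (A : E n → Matrix (Fin n) (Fin n) ℝ) (x : E n) : Matrix (Fin n) (Fin n) ℝ :=
  pdM i A x + Γ i * A x - A x * Γ i

theorem covM_mul {A B : E n → Matrix (Fin n) (Fin n) ℝ} {x : E n}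
    (Γ : Fin n → Matrix (Fin n) (Fin n) ℝ) (i : Fin n)
    (hA : ∀ a b, DifferentiableAt ℝ (fun y => A y a b) x)
    (hB : ∀ a b, DifferentiableAt ℝ (fun y => B y a b) x) :
    covM Γ i (fun y => A y * B y) x = covM Γ i A x * B x + A x * covM Γ i B x := by
  simp only [covM, pdM_mul i hA hB]
  noncomm_ring

theorem covM_smul_one {s : E n → ℝ} {x : E n} (Γ : Fin n → Matrix (Fin n) (Fin n) ℝ) (i : Fin n)
    (hs : DifferentiableAt ℝ s x) :
    covM Γ i (fun y => s y • (1 : Matrix (Fin n) (Fin n) ℝ)) x = pd i s x • 1 := by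
  have h : pdM i (fun y => s y • (1 : Matrix (Fin n) (Fin n) ℝ)) x = pd i s x • 1 := by
    ext a b
    simp only [pdM, Matrix.of_apply, Matrix.smul_apply, smul_eq_mul]
    rw [pd_mul i hs (by fun_prop), pd_const]
    ring
  simp [covM, h]

theorem covM_sub_smul {A B : E n → Matrix (Fin n) (Fin n) ℝ} {x : E n}
    (Γ : Fin n → Matrix (Fin n) (Fin n) ℝ) (i : Fin n) (c : ℝ)
    (hA : ∀ a b, DifferentiableAt ℝ (fun y => A y a b) x)
    (hB : ∀ a b, DifferentiableAt ℝ (fun y => B y a b) x) :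
    covM Γ i (fun y => A y - c • B y) x = covM Γ i A x - c • covM Γ i B x := by
  have h : pdM i (fun y => A y - c • B y) x = pdM i A x - c • pdM i B x := by
    ext a b
    simp only [pdM, Matrix.of_apply, Matrix.smul_apply, Matrix.sub_apply, smul_eq_mul]
    rw [pd_sub i (hA _ _) ((hB _ _).const_mul _), pd_mul i (by fun_prop) (hB _ _), pd_const]
    ring
  simp only [covM, h, mul_sub, sub_mul, mul_smul_comm, smul_mul_assoc, smul_sub, smul_add]
  abel

/-- The Newton tensors of a Codazzi tensor are divergence free. -/
theorem newtonT_divergence {A : E n → Matrix (Fin n) (Fin n) ℝ} {x : E n}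
    (Γ : Fin n → Matrix (Fin n) (Fin n) ℝ) (hA : ∀ a b, ContDiff ℝ ∞ fun y => A y a b)
    (hcod : ∀ i j a, covM Γ i A x a j = covM Γ j A x a i) (m : ℕ) (p : Fin n) :
    ∑ i, covM Γ i (fun y => newtonT m (A y)) x i p = 0 := by
  induction m generalizing p with
  | zero =>
    have h : ∀ i, covM Γ i (fun y => newtonT 0 (A y)) x = 0 := fun i => by
      have := covM_smul_one (x := x) (s := fun _ => (1 : ℝ)) Γ i (by fun_prop)
      simpa [newtonT_zero, pd_const] using this
    simp [h]
  | succ m ih =>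
    have dA : ∀ a b, DifferentiableAt ℝ (fun y => A y a b) x :=
      fun a b => smooth_differentiableAt (hA a b)
    have dT : ∀ a b, DifferentiableAt ℝ (fun y => newtonT m (A y) a b) x :=
      fun a b => smooth_differentiableAt (contDiff_newtonT m hA a b)
    have dS := smooth_differentiableAt (x := x) (contDiff_newtonS (m + 1) hA)
    have hT : ∀ i, covM Γ i (fun y => newtonT (m + 1) (A y)) x =
        pd i (fun y => newtonS (m + 1) (A y)) x • 1 - ((m : ℝ) + 1) •
          (covM Γ i (fun y => newtonT m (A y)) x * A x + newtonT m (A x) * covM Γ i A x) := by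
      intro i
      -- With `T A` in place of `A T` the divergence index sits on `T`, so the induction hypothesis
      -- applies to the term with `∇T`.
      simp_rw [newtonT_succ, newtonT_commute]
      rw [covM_sub_smul, covM_smul_one Γ i dS, covM_mul Γ i dT dA]
      · intro a b
        simp only [Matrix.smul_apply, smul_eq_mul]
        exact dS.mul_const _
      · intro a b
        simp only [Matrix.mul_apply]
        exact DifferentiableAt.fun_sum fun c _ => (dT _ _).mul (dA _ _)
    -- The connection terms cancel in the trace because `T` and `A` commute, so `pd_newtonS` also
    -- holds with the covariant derivative.
    have htr : (newtonT m (A x) * pdM p A x).trace =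
        (newtonT m (A x) * covM Γ p A x).trace := by
      rw [covM, mul_sub, mul_add, Matrix.trace_sub, Matrix.trace_add, ← mul_assoc, ← mul_assoc,
        Matrix.trace_mul_comm (newtonT m (A x) * A x), Matrix.trace_mul_comm _ (A x), ← mul_assoc,
        newtonT_commute, Matrix.trace_mul_comm (Γ p)]
      ring
    simp only [hT, Matrix.sub_apply, Matrix.smul_apply, Matrix.add_apply, smul_eq_mul,
      Finset.sum_sub_distrib, ← Finset.mul_sum, Finset.sum_add_distrib]
    have h1 : ∑ i, (covM Γ i (fun y => newtonT m (A y)) x * A x) i p = 0 := by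
      simp only [Matrix.mul_apply]
      rw [Finset.sum_comm]
      simp [← Finset.sum_mul, ih]
    -- Codazzi exchanges the derivative index with the lower index of `A`; the resulting trace
    -- cancels the derivative of `newtonS`.
    have h2 : ∑ i, (newtonT m (A x) * covM Γ i A x) i p =
        (newtonT m (A x) * covM Γ p A x).trace := by
      simp only [Matrix.mul_apply, Matrix.trace, Matrix.diag]
      exact Finset.sum_congr rfl fun i _ => Finset.sum_congr rfl fun q _ => by rw [hcod]
    rw [h1, h2, ← htr]
    simp [Matrix.one_apply, pd_newtonS p m dA]

/-- `∂ᵢ(ρ Tⁱ_p ξᵖ) = ρ ν S` for the Newton tensor `T` of a Codazzi tensor, a density `ρ` that is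
parallel up to the trace of the connection, and a vector field `ξ` whose derivative has the
symmetric part `ν A`. -/
theorem newton_flux_divergence {A G : E n → Matrix (Fin n) (Fin n) ℝ} {x : E n}
    {ρ : E n → ℝ} {ξ : Fin n → E n → ℝ} {ν : ℝ} {Ω : Matrix (Fin n) (Fin n) ℝ}
    (Γ : Fin n → Matrix (Fin n) (Fin n) ℝ) (hA : ∀ a b, ContDiff ℝ ∞ fun y => A y a b)
    (hρ : DifferentiableAt ℝ ρ x) (hξ : ∀ p, DifferentiableAt ℝ (ξ p) x)
    (hΓ : ∀ i j p, Γ i p j = Γ j p i)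
    (hcod : ∀ i j a, covM Γ i A x a j = covM Γ j A x a i)
    (hdρ : ∀ i, pd i ρ x = ρ x * ∑ a, Γ i a a)
    (hG : (G x).transpose = G x) (hAG : (A x * G x).transpose = A x * G x)
    (hΩ : Ω.transpose = -Ω)
    (hdξ : ∀ i p, pd i (ξ p) x + ∑ a, Γ i p a * ξ a x = ν * A x p i + (G x * Ω) p i) (m : ℕ) :
    ∑ i, pd i (fun y => ρ y * ∑ p, newtonT m (A y) i p * ξ p y) x =
      ρ x * ν * newtonS (m + 1) (A x) := by
  have dT : ∀ a b, DifferentiableAt ℝ (fun y => newtonT m (A y) a b) x :=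
    fun a b => smooth_differentiableAt (contDiff_newtonT m hA a b)
  have hdiv := newtonT_divergence Γ hA hcod m
  set T := newtonT m (A x) with hTdef
  have h1 : ∀ i, pd i (fun y => ρ y * ∑ p, newtonT m (A y) i p * ξ p y) x =
      ρ x * ((∑ a, Γ i a a) * ∑ p, T i p * ξ p x) + ρ x * ∑ p,
        (pdM i (fun y => newtonT m (A y)) x i p * ξ p x + T i p * pd i (ξ p) x) := by
    intro i
    rw [pd_mul i hρ (DifferentiableAt.fun_sum fun p _ => (dT _ _).fun_mul (hξ p)),
      pd_sum i fun p _ => (dT _ _).fun_mul (hξ p), hdρ, mul_assoc]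
    congr 2
    exact Finset.sum_congr rfl fun p _ => pd_mul i (dT _ _) (hξ p)
  have h2 : ∀ i p, pdM i (fun y => newtonT m (A y)) x i p =
      covM Γ i (fun y => newtonT m (A y)) x i p - ∑ a, Γ i i a * T a p + ∑ a, T i a * Γ i a p := by
    intro i p
    simp only [covM, Matrix.mul_apply, ← hTdef, Matrix.sub_apply, Matrix.add_apply]; ring
  have h3 : ∀ i p, pd i (ξ p) x = ν * A x p i + (G x * Ω) p i - ∑ a, Γ i p a * ξ a x :=
    fun i p => by rw [← hdξ]; ring
  -- `T G` is symmetric and `Ω` antisymmetric, so only the symmetric part of `∇ξ` survives.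
  have hskew : ∑ i, ∑ p, T i p * (G x * Ω) p i = 0 := by
    have e1 : ∑ i, ∑ p, T i p * (G x * Ω) p i = (T * G x * Ω).trace := by
      rw [mul_assoc]; simp [Matrix.trace, Matrix.mul_apply (M := T)]
    have e2 : (T * G x * Ω).trace = -(T * G x * Ω).trace := by
      conv_lhs => rw [← Matrix.trace_transpose, Matrix.transpose_mul,
        newtonT_mul_transpose m hG hAG, hΩ]
      rw [Matrix.neg_mul, Matrix.trace_neg, Matrix.trace_mul_comm]
    rw [e1]; linarith
  have hS : ∑ i, ∑ p, T i p * A x p i = newtonS (m + 1) (A x) := by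
    rw [newtonS_succ]; simp [Matrix.trace, Matrix.mul_apply, ← hTdef]
  have hcov : ∑ i, ∑ p, covM Γ i (fun y => newtonT m (A y)) x i p * ξ p x = 0 := by
    rw [Finset.sum_comm]
    simp [← Finset.sum_mul, hdiv]
  -- By symmetry of `Γ`, the derivative of `ρ` cancels the traced connection term in the divergence
  -- of `T`; the other connection term of `T` cancels that of `ξ` in `hc2`.
  have hc1 : ∑ i, (∑ a, Γ i a a) * ∑ p, T i p * ξ p x =
      ∑ i, ∑ p, (∑ a, Γ i i a * T a p) * ξ p x := by
    simp only [Finset.sum_mul_sum]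
    rw [Finset.sum_comm]
    refine Finset.sum_congr rfl fun a _ => ?_
    simp only [Finset.sum_mul]
    rw [Finset.sum_comm]
    refine Finset.sum_congr rfl fun p _ => Finset.sum_congr rfl fun i _ => ?_
    rw [hΓ i a a]
    ring
  have hc2 : ∑ i, ∑ p, (∑ a, T i a * Γ i a p) * ξ p x =
      ∑ i, ∑ p, T i p * ∑ a, Γ i p a * ξ a x := by
    refine Finset.sum_congr rfl fun i _ => ?_
    simp only [Finset.sum_mul, Finset.mul_sum]
    rw [Finset.sum_comm]
    refine Finset.sum_congr rfl fun p _ => Finset.sum_congr rfl fun a _ => by ring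
  simp only [h1, ← mul_add, ← Finset.mul_sum, mul_assoc]
  congr 1
  rw [Finset.sum_add_distrib, hc1, ← hS]
  simp only [h2, h3, Finset.sum_add_distrib, add_mul, sub_mul, mul_add, mul_sub,
    Finset.sum_sub_distrib, hcov, hc2, hskew]
  simp only [Finset.mul_sum, mul_left_comm]
  ring

end NewtonDivergence

/-! ### Smoothness of inverse matrices and the density `√det g`. -/

section MatrixFields

variable {n : ℕ}

theorem contDiff_matrix_det {ι : Type} [Fintype ι] [DecidableEq ι] {A : E n → Matrix ι ι ℝ}
    (hA : ∀ i j, ContDiff ℝ ∞ fun y => A y i j) : ContDiff ℝ ∞ fun y => (A y).det := by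
  simp_rw [Matrix.det_apply']
  exact ContDiff.sum fun σ _ => contDiff_const.mul (contDiff_prod fun i _ => hA _ _)

theorem contDiff_matrix_inv {A : E n → Matrix (Fin n) (Fin n) ℝ}
    (hA : ∀ i j, ContDiff ℝ ∞ fun y => A y i j) (hdet : ∀ y, IsUnit (A y).det) (i j : Fin n) :
    ContDiff ℝ ∞ fun y => (A y)⁻¹ i j := by
  simp_rw [Matrix.inv_def, Ring.inverse_eq_inv', Matrix.smul_apply, smul_eq_mul,
    Matrix.adjugate_apply]
  refine ((contDiff_matrix_det hA).inv fun y => (hdet y).ne_zero).mul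
    (contDiff_matrix_det fun a b => ?_)
  simp only [Matrix.updateRow_apply]
  split_ifs
  · exact contDiff_const
  · exact hA _ _

/-- `Γᵃ_{ia} = ½ gᵃᵇ ∂ᵢ g_{ab}`. -/
theorem christoffel_trace {g : Metric2 n} (hsymm : ∀ x i j, g x i j = g x j i) (x : E n)
    (i : Fin n) : ∑ a, christoffel g x a i a = (1 / 2) * ((g x)⁻¹ * pdM i g x).trace := by
  have hg : ∀ a b, (fun y => g y a b) = fun y => g y b a := fun a b => funext fun y => hsymm _ _ _
  have hinv : ∀ a b, (g x)⁻¹ a b = (g x)⁻¹ b a := fun a b => by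
    have : (g x).transpose = g x := by ext a b; exact hsymm _ _ _
    conv_lhs => rw [← this, ← Matrix.transpose_nonsing_inv]
    rfl
  simp only [christoffel, ← Finset.mul_sum, Matrix.trace, Matrix.diag, Matrix.mul_apply, pdM,
    Matrix.of_apply]
  congr 1
  -- The two remaining derivatives of the metric are antisymmetric in `a, b` and meet the symmetric
  -- inverse metric.
  have key : ∑ a, ∑ b, (g x)⁻¹ a b * (pd a (fun y => g y i b) x - pd b (fun y => g y i a) x) = 0 := by
    simp only [mul_sub, Finset.sum_sub_distrib]
    rw [sub_eq_zero]
    conv_rhs => rw [Finset.sum_comm]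
    exact Finset.sum_congr rfl fun a _ => Finset.sum_congr rfl fun b _ => by rw [hinv]
  rw [← add_zero (∑ a, ∑ b, (g x)⁻¹ a b * pd i (fun y => g y b a) x), ← key,
    ← Finset.sum_add_distrib]
  refine Finset.sum_congr rfl fun a _ => ?_
  rw [← Finset.sum_add_distrib]
  refine Finset.sum_congr rfl fun b _ => ?_
  rw [hg a b]
  ring

/-- The Riemannian density is parallel: Jacobi's formula combined with `christoffel_trace`. It
supplies the hypothesis `hdρ` of `newton_flux_divergence`. -/
theorem pd_sqrt_det {g : Metric2 n} (hg : ∀ i j, ContDiff ℝ ∞ fun y => g y i j)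
    (hsymm : ∀ x i j, g x i j = g x j i) (x : E n) (hdet : 0 < (g x).det) (i : Fin n) :
    pd i (fun y => Real.sqrt (g y).det) x =
      Real.sqrt (g x).det * ∑ a, christoffel g x a i a := by
  have hd := smooth_differentiableAt (x := x) (contDiff_matrix_det hg)
  rw [pd_comp (φ := Real.sqrt) i (Real.hasDerivAt_sqrt hdet.ne') hd, christoffel_trace hsymm,
    pd_matrix_det i fun a b => smooth_differentiableAt (hg a b)]
  have hadj : (g x).adjugate = (g x).det • (g x)⁻¹ := by
    rw [Matrix.inv_def, Ring.inverse_eq_inv', smul_smul, mul_inv_cancel₀ hdet.ne', one_smul]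
  rw [hadj, Matrix.smul_mul, Matrix.trace_smul, smul_eq_mul]
  have hs : Real.sqrt (g x).det ≠ 0 := (Real.sqrt_pos.2 hdet).ne'
  have h2 : (g x).det = Real.sqrt (g x).det * Real.sqrt (g x).det :=
    (Real.mul_self_sqrt hdet.le).symm
  rw [show (Matrix.of fun a b => pd i (fun y => g y a b) x) = pdM i g x from rfl]
  field_simp
  rw [sq, ← h2]

end MatrixFields

/-! ### Hypersurfaces of the hyperboloid: adapted frame, Gauss and Weingarten formulas. -/

section Hyperboloid

variable {n : ℕ}

/-- The signature of Minkowski space of dimension `n + 2`. -/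
def minkSign : Fin n ⊕ Fin 2 → ℝ := Sum.elim (fun _ => 1) ![-1, 1]

/-- The Minkowski inner product. -/
def mink (u v : Fin n ⊕ Fin 2 → ℝ) : ℝ := ∑ α, minkSign α * u α * v α

/-- The componentwise partial derivative of a vector valued map. -/
def pdV (i : Fin n) (u : E n → Fin n ⊕ Fin 2 → ℝ) (x : E n) : Fin n ⊕ Fin 2 → ℝ :=
  fun α => pd i (fun y => u y α) x

theorem mink_comm (u v : Fin n ⊕ Fin 2 → ℝ) : mink u v = mink v u :=
  Finset.sum_congr rfl fun α _ => by ring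

theorem mink_add (u v w : Fin n ⊕ Fin 2 → ℝ) : mink (u + v) w = mink u w + mink v w := by
  simp only [mink, Pi.add_apply, ← Finset.sum_add_distrib]
  exact Finset.sum_congr rfl fun α _ => by ring

theorem mink_smul (c : ℝ) (u w : Fin n ⊕ Fin 2 → ℝ) : mink (c • u) w = c * mink u w := by
  simp only [mink, Pi.smul_apply, smul_eq_mul, Finset.mul_sum]
  exact Finset.sum_congr rfl fun α _ => by ring

theorem mink_sum {κ : Type*} (s : Finset κ) (u : κ → Fin n ⊕ Fin 2 → ℝ) (w : Fin n ⊕ Fin 2 → ℝ) :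
    mink (∑ a ∈ s, u a) w = ∑ a ∈ s, mink (u a) w := by
  simp only [mink, Finset.sum_apply, Finset.mul_sum, Finset.sum_mul]
  exact Finset.sum_comm

theorem pd_mink {u v : E n → Fin n ⊕ Fin 2 → ℝ} (hu : ∀ α, ContDiff ℝ ∞ fun y => u y α)
    (hv : ∀ α, ContDiff ℝ ∞ fun y => v y α) (i : Fin n) (x : E n) :
    pd i (fun y => mink (u y) (v y)) x = mink (pdV i u x) (v x) + mink (u x) (pdV i v x) := by
  have du := fun α => smooth_differentiableAt (x := x) (hu α)
  have dv := fun α => smooth_differentiableAt (x := x) (hv α)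
  simp only [mink, pdV, ← Finset.sum_add_distrib]
  rw [pd_sum i fun α _ => ((du α).const_mul _).fun_mul (dv α)]
  refine Finset.sum_congr rfl fun α _ => ?_
  rw [pd_mul i ((du α).const_mul _) (dv α), pd_mul i (by fun_prop) (du α), pd_const]
  ring

theorem contDiff_mink {u v : E n → Fin n ⊕ Fin 2 → ℝ} (hu : ∀ α, ContDiff ℝ ∞ fun y => u y α)
    (hv : ∀ α, ContDiff ℝ ∞ fun y => v y α) : ContDiff ℝ ∞ fun y => mink (u y) (v y) :=
  ContDiff.sum fun α _ => (contDiff_const.mul (hu α)).mul (hv α)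

/-- `Φ` is an immersed hypersurface of the unit hyperboloid of Minkowski space with unit normal `N`
and induced metric `g`. -/
structure IsHyperboloidImmersion (Φ N : E n → Fin n ⊕ Fin 2 → ℝ) (g : Metric2 n) : Prop where
  smooth : ∀ α, ContDiff ℝ ∞ fun y => Φ y α
  smooth_normal : ∀ α, ContDiff ℝ ∞ fun y => N y α
  norm : ∀ x, mink (Φ x) (Φ x) = -1
  norm_normal : ∀ x, mink (N x) (N x) = 1
  orth : ∀ x, mink (Φ x) (N x) = 0
  orth_tangent : ∀ x i, mink (pdV i Φ x) (N x) = 0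
  metric : ∀ x i j, g x i j = mink (pdV i Φ x) (pdV j Φ x)
  det_pos : ∀ x, 0 < (g x).det

/-- The second fundamental form. -/
def secondFF (Φ N : E n → Fin n ⊕ Fin 2 → ℝ) (x : E n) : Matrix (Fin n) (Fin n) ℝ :=
  Matrix.of fun i j => mink (pdV i (pdV j Φ) x) (N x)

/-- The shape operator `A^s_i = g^{sl} h_{li}`. -/
def shapeOp (Φ N : E n → Fin n ⊕ Fin 2 → ℝ) (g : Metric2 n) (x : E n) :
    Matrix (Fin n) (Fin n) ℝ := (g x)⁻¹ * secondFF Φ N x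

namespace IsHyperboloidImmersion

variable {Φ N : E n → Fin n ⊕ Fin 2 → ℝ} {g : Metric2 n}

theorem symm (H : IsHyperboloidImmersion Φ N g) (x : E n) (i j : Fin n) :
    g x i j = g x j i := by
  rw [H.metric, H.metric, mink_comm]

theorem transpose (H : IsHyperboloidImmersion Φ N g) (x : E n) : (g x).transpose = g x := by
  ext i j; exact H.symm x j i

theorem inv_transpose (H : IsHyperboloidImmersion Φ N g) (x : E n) :
    (g x)⁻¹.transpose = (g x)⁻¹ := by
  rw [Matrix.transpose_nonsing_inv, H.transpose]

theorem isUnit_det (H : IsHyperboloidImmersion Φ N g) (x : E n) : IsUnit (g x).det :=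
  (H.det_pos x).ne'.isUnit

theorem smooth_tangent (H : IsHyperboloidImmersion Φ N g) (i : Fin n) (α) :
    ContDiff ℝ ∞ fun y => pdV i Φ y α := contDiff_pd (H.smooth α) i

theorem smooth_second (H : IsHyperboloidImmersion Φ N g) (i j : Fin n) (α) :
    ContDiff ℝ ∞ fun y => pdV i (pdV j Φ) y α := contDiff_pd (H.smooth_tangent j α) i

theorem second_symm (H : IsHyperboloidImmersion Φ N g) (x : E n) (i j : Fin n) :
    pdV i (pdV j Φ) x = pdV j (pdV i Φ) x :=
  funext fun α => pd_comm (H.smooth α) i j x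

theorem smooth_metric (H : IsHyperboloidImmersion Φ N g) (i j : Fin n) :
    ContDiff ℝ ∞ fun y => g y i j := by
  simp_rw [H.metric]
  exact contDiff_mink (H.smooth_tangent i) (H.smooth_tangent j)

theorem smooth_inv (H : IsHyperboloidImmersion Φ N g) (i j : Fin n) :
    ContDiff ℝ ∞ fun y => (g y)⁻¹ i j :=
  contDiff_matrix_inv H.smooth_metric H.isUnit_det i j

theorem smooth_secondFF (H : IsHyperboloidImmersion Φ N g) (i j : Fin n) :
    ContDiff ℝ ∞ fun y => secondFF Φ N y i j :=
  contDiff_mink (H.smooth_second i j) H.smooth_normal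

theorem smooth_shapeOp (H : IsHyperboloidImmersion Φ N g) (i j : Fin n) :
    ContDiff ℝ ∞ fun y => shapeOp Φ N g y i j := by
  simp only [shapeOp, Matrix.mul_apply]
  exact ContDiff.sum fun l _ => (H.smooth_inv i l).mul (H.smooth_secondFF l j)

theorem smooth_christoffel (H : IsHyperboloidImmersion Φ N g) (s i j : Fin n) :
    ContDiff ℝ ∞ fun y => christoffel g y s i j :=
  contDiff_const.mul (ContDiff.sum fun l _ => (H.smooth_inv s l).mul
    (((contDiff_pd (H.smooth_metric j l) i).add (contDiff_pd (H.smooth_metric i l) j)).sub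
      (contDiff_pd (H.smooth_metric i j) l)))

theorem orth_position (H : IsHyperboloidImmersion Φ N g) (x : E n) (i : Fin n) :
    mink (pdV i Φ x) (Φ x) = 0 := by
  have h := pd_mink H.smooth H.smooth i x
  simp only [H.norm, pd_const] at h
  rw [mink_comm (Φ x)] at h
  linarith

/-- The tangent vectors, the position vector and the normal form a basis of Minkowski space. -/
theorem decompose (H : IsHyperboloidImmersion Φ N g) (x : E n) (v : Fin n ⊕ Fin 2 → ℝ) :
    v = ∑ s, (∑ l, (g x)⁻¹ s l * mink v (pdV l Φ x)) • pdV s Φ x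
      - mink v (Φ x) • Φ x + mink v (N x) • N x := by
  -- The columns of `B` are the frame `∂_iΦ, Φ, N`; `G` is the inverse of its Minkowski Gram matrix,
  -- block diagonal by the orthogonality relations.
  let B : Matrix (Fin n ⊕ Fin 2) (Fin n ⊕ Fin 2) ℝ :=
    Matrix.of fun α => Sum.elim (fun i => pdV i Φ x α) ![Φ x α, N x α]
  let G : Matrix (Fin n ⊕ Fin 2) (Fin n ⊕ Fin 2) ℝ :=
    Matrix.fromBlocks (g x)⁻¹ 0 0 (Matrix.diagonal ![-1, 1])
  have hB : B.transpose * Matrix.diagonal minkSign * B =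
      Matrix.fromBlocks (g x) 0 0 (Matrix.diagonal ![-1, 1]) := by
    have hm : ∀ β γ : Fin n ⊕ Fin 2, (B.transpose * Matrix.diagonal minkSign * B : Matrix (Fin n ⊕ Fin 2) (Fin n ⊕ Fin 2) ℝ) β γ =
        mink (fun α => B α β) (fun α => B α γ) := by
      intro β γ
      rw [Matrix.mul_apply]
      simp only [Matrix.mul_diagonal, Matrix.transpose_apply, mink]
      exact Finset.sum_congr rfl fun α _ => by ring
    ext β γ
    rw [hm]
    rcases β with i | β <;> rcases γ with j | γ
    · simp [B, H.metric]
    · fin_cases γ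
      · simpa [B] using H.orth_position x i
      · simpa [B] using H.orth_tangent x i
    · fin_cases β
      · simpa [B, mink_comm (Φ x)] using H.orth_position x j
      · simpa [B, mink_comm (N x)] using H.orth_tangent x j
    · fin_cases β <;> fin_cases γ
      · simpa [B] using H.norm x
      · simpa [B] using H.orth x
      · simpa [B, mink_comm (N x)] using H.orth x
      · simpa [B] using H.norm_normal x
  have hG : G * (B.transpose * Matrix.diagonal minkSign * B) = 1 := by
    rw [hB, Matrix.fromBlocks_multiply, Matrix.nonsing_inv_mul _ (H.isUnit_det x)]
    simp only [Matrix.mul_zero, Matrix.zero_mul, add_zero, zero_add, Matrix.diagonal_mul_diagonal]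
    rw [← Matrix.fromBlocks_one, ← Matrix.diagonal_one]
    congr
    ext i; fin_cases i <;> simp
  -- For square matrices a left inverse is a right inverse: this is the completeness of the frame.
  have h1 : B * (G * (B.transpose * Matrix.diagonal minkSign)) = 1 :=
    mul_eq_one_comm.1 (by rwa [mul_assoc] )
  have h2 : v = B.mulVec (G.mulVec (B.transpose.mulVec ((Matrix.diagonal minkSign).mulVec v))) := by
    simp only [Matrix.mulVec_mulVec]
    rw [h1, Matrix.one_mulVec]
  have h3 : B.transpose.mulVec ((Matrix.diagonal minkSign).mulVec v) =
      Sum.elim (fun l => mink v (pdV l Φ x)) ![mink v (Φ x), mink v (N x)] := by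
    have hm : ∀ β, (B.transpose.mulVec ((Matrix.diagonal minkSign).mulVec v)) β =
        mink v (fun α => B α β) := by
      intro β
      simp only [Matrix.mulVec, dotProduct, Matrix.transpose_apply, mink, Matrix.diagonal_apply]
      exact Finset.sum_congr rfl fun α _ => by simp; ring
    ext β
    rw [hm]
    rcases β with i | β
    · simp [B]
    · fin_cases β <;> simp [B]
  rw [h3] at h2
  conv_lhs => rw [h2]
  ext α
  simp [B, G, Matrix.mulVec, dotProduct, Fintype.sum_sum_type, Matrix.diagonal_apply,
    Finset.sum_apply]
  rw [sub_eq_add_neg, add_assoc]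
  congr 1
  · exact Finset.sum_congr rfl fun s _ => mul_comm _ _
  · ring

theorem mink_tangent_comb (H : IsHyperboloidImmersion Φ N g) (x : E n) (c : Fin n → ℝ) (a b : ℝ)
    (q : Fin n) : mink (∑ s, c s • pdV s Φ x + a • Φ x + b • N x) (pdV q Φ x) =
      ∑ s, g x q s * c s := by
  rw [mink_add, mink_add, mink_sum, mink_smul, mink_smul, mink_comm (Φ x), H.orth_position,
    mink_comm (N x), H.orth_tangent]
  simp only [mink_smul, ← H.metric, mul_zero, add_zero]
  exact Finset.sum_congr rfl fun s _ => by rw [H.symm, mul_comm]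

/-- Pairing with the tangent vectors removes `Φ` and `N` and leaves `g c = 0`. This extracts the
tangential part of an identity between frame expansions. -/
theorem tangent_coeff_eq_zero (H : IsHyperboloidImmersion Φ N g) (x : E n) {c : Fin n → ℝ} {a b : ℝ}
    (h : ∑ s, c s • pdV s Φ x + a • Φ x + b • N x = 0) : c = 0 := by
  have h1 : (g x).mulVec c = 0 := by
    ext q
    simp only [Matrix.mulVec, dotProduct]
    rw [← H.mink_tangent_comb x c a b q, h]
    simp [mink]
  rw [← Matrix.one_mulVec c, ← Matrix.nonsing_inv_mul _ (H.isUnit_det x), ← Matrix.mulVec_mulVec,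
    h1, Matrix.mulVec_zero]

/-- Insert `g_{ij} = ⟨∂_iΦ, ∂_jΦ⟩` into the definition; by symmetry of second derivatives all but
one of the products cancel. -/
theorem christoffel_eq (H : IsHyperboloidImmersion Φ N g) (x : E n) (s i j : Fin n) :
    christoffel g x s i j = ∑ l, (g x)⁻¹ s l * mink (pdV i (pdV j Φ) x) (pdV l Φ x) := by
  have hd : ∀ a b c, pd a (fun y => g y b c) x = mink (pdV a (pdV b Φ) x) (pdV c Φ x) +
      mink (pdV a (pdV c Φ) x) (pdV b Φ x) := fun a b c => by
    simp_rw [H.metric]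
    rw [pd_mink (H.smooth_tangent b) (H.smooth_tangent c), mink_comm (pdV b Φ x)]
  rw [christoffel, Finset.mul_sum]
  refine Finset.sum_congr rfl fun l _ => ?_
  rw [hd, hd, hd, H.second_symm x j i, H.second_symm x l i, H.second_symm x l j]
  ring

theorem christoffel_symm (H : IsHyperboloidImmersion Φ N g) (x : E n) (s i j : Fin n) :
    christoffel g x s i j = christoffel g x s j i := by
  simp only [H.christoffel_eq, H.second_symm x i j]

theorem secondFF_symm (H : IsHyperboloidImmersion Φ N g) (x : E n) (i j : Fin n) :
    secondFF Φ N x i j = secondFF Φ N x j i := by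
  simp only [secondFF, Matrix.of_apply, H.second_symm x i j]

/-- Differentiating `⟨∂_jΦ, Φ⟩ = 0` determines the component along `Φ`, and `⟨Φ, Φ⟩ = -1` makes its
coefficient `+g_{ij}`. This term accounts for the difference between `R` and `R̃`. -/
theorem gauss_formula (H : IsHyperboloidImmersion Φ N g) (x : E n) (i j : Fin n) :
    pdV i (pdV j Φ) x = ∑ s, christoffel g x s i j • pdV s Φ x + g x i j • Φ x
      + secondFF Φ N x i j • N x := by
  have h1 : mink (pdV i (pdV j Φ) x) (Φ x) = -g x i j := by
    have h := pd_mink (H.smooth_tangent j) H.smooth i x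
    simp only [H.orth_position, pd_const] at h
    rw [mink_comm (pdV j Φ x), ← H.metric] at h
    linarith
  conv_lhs => rw [H.decompose x (pdV i (pdV j Φ) x), h1]
  simp only [H.christoffel_eq, neg_smul, sub_neg_eq_add]
  rfl

/-- Differentiating `⟨Φ, N⟩ = 0` and `⟨N, N⟩ = 1` shows that `∂_i N` is tangent; differentiating
`⟨∂_lΦ, N⟩ = 0` identifies it. -/
theorem weingarten (H : IsHyperboloidImmersion Φ N g) (x : E n) (i : Fin n) :
    pdV i N x = -∑ s, shapeOp Φ N g x s i • pdV s Φ x := by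
  have h1 : mink (pdV i N x) (Φ x) = 0 := by
    have h := pd_mink H.smooth H.smooth_normal i x
    simp only [H.orth, pd_const, H.orth_tangent] at h
    rw [mink_comm]
    linarith
  have h2 : mink (pdV i N x) (N x) = 0 := by
    have h := pd_mink H.smooth_normal H.smooth_normal i x
    simp only [H.norm_normal, pd_const] at h
    rw [mink_comm (N x)] at h
    linarith
  have h3 : ∀ l, mink (pdV i N x) (pdV l Φ x) = -secondFF Φ N x l i := fun l => by
    have h := pd_mink (H.smooth_tangent l) H.smooth_normal i x
    simp only [H.orth_tangent, pd_const] at h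
    rw [mink_comm (pdV l Φ x), show mink (pdV i (pdV l Φ) x) (N x) = secondFF Φ N x i l from rfl,
      H.secondFF_symm] at h
    linarith
  conv_lhs => rw [H.decompose x (pdV i N x), h1, h2]
  simp [h3, shapeOp, Matrix.mul_apply]

end IsHyperboloidImmersion

end Hyperboloid

/-! ### The Gauss, Codazzi and Killing equations. -/

section GaussCodazzi

variable {n : ℕ}

theorem pdV_add {u v : E n → Fin n ⊕ Fin 2 → ℝ} {x : E n} (i : Fin n)
    (hu : ∀ α, DifferentiableAt ℝ (fun y => u y α) x)
    (hv : ∀ α, DifferentiableAt ℝ (fun y => v y α) x) :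
    pdV i (fun y => u y + v y) x = pdV i u x + pdV i v x :=
  funext fun α => pd_add i (hu α) (hv α)

theorem pdV_smul {c : E n → ℝ} {u : E n → Fin n ⊕ Fin 2 → ℝ} {x : E n} (i : Fin n)
    (hc : DifferentiableAt ℝ c x) (hu : ∀ α, DifferentiableAt ℝ (fun y => u y α) x) :
    pdV i (fun y => c y • u y) x = pd i c x • u x + c x • pdV i u x :=
  funext fun α => pd_mul i hc (hu α)

theorem pdV_sum_smul {c : Fin n → E n → ℝ} {u : Fin n → E n → Fin n ⊕ Fin 2 → ℝ} {x : E n}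
    (i : Fin n) (hc : ∀ s, DifferentiableAt ℝ (c s) x)
    (hu : ∀ s α, DifferentiableAt ℝ (fun y => u s y α) x) :
    pdV i (fun y => ∑ s, c s y • u s y) x = ∑ s, (pd i (c s) x • u s x + c s x • pdV i (u s) x) := by
  funext α
  simp only [pdV, Finset.sum_apply, Pi.smul_apply, smul_eq_mul, Pi.add_apply]
  rw [pd_sum i fun s _ => (hc s).fun_mul (hu s α)]
  exact Finset.sum_congr rfl fun s _ => pd_mul i (hc s) (hu s α)

namespace IsHyperboloidImmersion

variable {Φ N : E n → Fin n ⊕ Fin 2 → ℝ} {g : Metric2 n}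

/-- The structure equations of the frame in one formula. Applied to `∂_jΦ`, `∂_jN` and `L Φ` it
yields the equations of Gauss, Codazzi and Killing respectively. -/
theorem pdV_tangent_comb (H : IsHyperboloidImmersion Φ N g) (x : E n) (i : Fin n)
    {c : Fin n → E n → ℝ} {a b : E n → ℝ} (hc : ∀ s, DifferentiableAt ℝ (c s) x)
    (ha : DifferentiableAt ℝ a x) (hb : DifferentiableAt ℝ b x) :
    pdV i (fun y => ∑ s, c s y • pdV s Φ y + a y • Φ y + b y • N y) x =
      ∑ s, (pd i (c s) x + ∑ m, christoffel g x s i m * c m x + (if s = i then a x else 0)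
          - b x * shapeOp Φ N g x s i) • pdV s Φ x
        + (pd i a x + ∑ m, c m x * g x i m) • Φ x
        + (pd i b x + ∑ m, c m x * secondFF Φ N x i m) • N x := by
  have dΦ : ∀ α, DifferentiableAt ℝ (fun y => Φ y α) x :=
    fun α => smooth_differentiableAt (H.smooth α)
  have dN : ∀ α, DifferentiableAt ℝ (fun y => N y α) x :=
    fun α => smooth_differentiableAt (H.smooth_normal α)
  have dT : ∀ s α, DifferentiableAt ℝ (fun y => pdV s Φ y α) x :=
    fun s α => smooth_differentiableAt (H.smooth_tangent s α)
  have d1 : ∀ α, DifferentiableAt ℝ (fun y => (∑ s, c s y • pdV s Φ y) α) x := fun α => by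
    simp only [Finset.sum_apply, Pi.smul_apply, smul_eq_mul]
    exact DifferentiableAt.fun_sum fun s _ => (hc s).fun_mul (dT s α)
  have d2 : ∀ α, DifferentiableAt ℝ (fun y => (a y • Φ y) α) x := fun α => ha.fun_mul (dΦ α)
  have d3 : ∀ α, DifferentiableAt ℝ (fun y => (b y • N y) α) x := fun α => hb.fun_mul (dN α)
  rw [pdV_add (u := fun y => ∑ s, c s y • pdV s Φ y + a y • Φ y) i
    (fun α => (d1 α).fun_add (d2 α)) d3, pdV_add i d1 d2, pdV_sum_smul i hc dT,
    pdV_smul i ha dΦ, pdV_smul i hb dN, H.weingarten]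
  have e1 : ∑ s, c s x • pdV i (pdV s Φ) x =
      ∑ s, (∑ m, christoffel g x s i m * c m x) • pdV s Φ x + (∑ m, c m x * g x i m) • Φ x
        + (∑ m, c m x * secondFF Φ N x i m) • N x := by
    simp_rw [H.gauss_formula x i, smul_add, Finset.sum_add_distrib, Finset.sum_smul,
      Finset.smul_sum, smul_smul]
    congr 2
    rw [Finset.sum_comm]
    exact Finset.sum_congr rfl fun s _ => Finset.sum_congr rfl fun m _ => by rw [mul_comm]
  have e2 : a x • pdV i Φ x = ∑ s, (if s = i then a x else 0) • pdV s Φ x := by simp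
  rw [Finset.sum_add_distrib, e1, e2]
  simp only [add_smul, sub_smul, Finset.sum_add_distrib, Finset.sum_sub_distrib, smul_neg,
    Finset.smul_sum, mul_smul]
  abel

/-- The tangential part of `∂_k ∂_i ∂_jΦ = ∂_i ∂_k ∂_jΦ`. -/
theorem gauss_aux (H : IsHyperboloidImmersion Φ N g) (x : E n) (k i j s : Fin n) :
    riemUp g x k i s j + (if s = k then g x i j else 0) - (if s = i then g x k j else 0)
      - secondFF Φ N x i j * shapeOp Φ N g x s k + secondFF Φ N x k j * shapeOp Φ N g x s i = 0 := by
  have hd : ∀ i, pdV i (pdV j Φ) = fun y => ∑ s, christoffel g y s i j • pdV s Φ y + g y i j • Φ y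
      + secondFF Φ N y i j • N y := fun i => funext fun y => H.gauss_formula y i j
  have hsymm : pdV k (pdV i (pdV j Φ)) x = pdV i (pdV k (pdV j Φ)) x :=
    funext fun α => pd_comm (H.smooth_tangent j α) k i x
  rw [hd i, hd k] at hsymm
  have dd := fun k i =>
    H.pdV_tangent_comb (c := fun s y => christoffel g y s i j) (a := fun y => g y i j)
      (b := fun y => secondFF Φ N y i j) x k
      (fun s => smooth_differentiableAt (H.smooth_christoffel s i j))
      (smooth_differentiableAt (H.smooth_metric i j))
      (smooth_differentiableAt (H.smooth_secondFF i j))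
  rw [dd k i, dd i k, ← sub_eq_zero] at hsymm
  have h0 := H.tangent_coeff_eq_zero x (c := fun s => (riemUp g x k i s j
    + (if s = k then g x i j else 0) - (if s = i then g x k j else 0)
      - secondFF Φ N x i j * shapeOp Φ N g x s k + secondFF Φ N x k j * shapeOp Φ N g x s i))
    (a := (pd k (fun y => g y i j) x + ∑ m, christoffel g x m i j * g x k m)
      - (pd i (fun y => g y k j) x + ∑ m, christoffel g x m k j * g x i m))
    (b := (pd k (fun y => secondFF Φ N y i j) x + ∑ m, christoffel g x m i j * secondFF Φ N x k m)
      - (pd i (fun y => secondFF Φ N y k j) x + ∑ m, christoffel g x m k j * secondFF Φ N x i m))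
    (by
      rw [← hsymm]
      simp only [riemUp, Finset.sum_sub_distrib, sub_smul, add_smul, Finset.sum_add_distrib]
      abel)
  exact congrFun h0 s

theorem metric_mul_shapeOp (H : IsHyperboloidImmersion Φ N g) (x : E n) :
    g x * shapeOp Φ N g x = secondFF Φ N x := by
  rw [shapeOp, ← mul_assoc, Matrix.mul_nonsing_inv _ (H.isUnit_det x), one_mul]

/-- The Gauss equation. -/
theorem gauss_equation (H : IsHyperboloidImmersion Φ N g) (x : E n) (k i q j : Fin n) :
    riemMod g x k i q j = secondFF Φ N x q k * secondFF Φ N x i j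
      - secondFF Φ N x k j * secondFF Φ N x q i := by
  have h1 : ∀ a, ∑ t, g x q t * shapeOp Φ N g x t a = secondFF Φ N x q a := fun a => by
    rw [← H.metric_mul_shapeOp, Matrix.mul_apply]
  have h2 : ∀ t, riemUp g x k i t j = -(if t = k then g x i j else 0)
      + (if t = i then g x k j else 0) + secondFF Φ N x i j * shapeOp Φ N g x t k
      - secondFF Φ N x k j * shapeOp Φ N g x t i := fun t => by
    linarith [H.gauss_aux x k i j t]
  simp only [riemMod, riem, h2, mul_sub, mul_add, Finset.sum_add_distrib, Finset.sum_sub_distrib,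
    mul_left_comm (g x q _), ← Finset.mul_sum, h1]
  simp only [mul_neg, mul_ite, mul_zero, Finset.sum_neg_distrib, Finset.sum_ite_eq',
    Finset.mem_univ, if_true]
  rw [H.symm x q k, H.symm x q i]
  ring

theorem riemModUp_eq (H : IsHyperboloidImmersion Φ N g) (x : E n) (i j s l : Fin n) :
    riemModUp g x i j s l = shapeOp Φ N g x s i * shapeOp Φ N g x l j
      - shapeOp Φ N g x l i * shapeOp Φ N g x s j := by
  simp only [riemModUp, H.gauss_equation, shapeOp, Matrix.mul_apply, Finset.sum_mul_sum]
  conv_rhs => rw [Finset.sum_comm (f := fun a b => (g x)⁻¹ l a * _ * ((g x)⁻¹ s b * _))]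
  rw [← Finset.sum_sub_distrib]
  refine Finset.sum_congr rfl fun p _ => ?_
  rw [← Finset.sum_sub_distrib]
  refine Finset.sum_congr rfl fun q _ => ?_
  rw [H.secondFF_symm x j q, H.secondFF_symm x i q]
  ring

/-- The Codazzi equation. -/
theorem codazzi (H : IsHyperboloidImmersion Φ N g) (x : E n) (i j a : Fin n) :
    covM (fun i => Matrix.of fun a b => christoffel g x a i b) i (shapeOp Φ N g) x a j =
      covM (fun i => Matrix.of fun a b => christoffel g x a i b) j (shapeOp Φ N g) x a i := by
  have hd : ∀ i, pdV i N = fun y => ∑ s, (-shapeOp Φ N g y s i) • pdV s Φ y + (0 : ℝ) • Φ y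
      + (0 : ℝ) • N y := fun i => funext fun y => by
    rw [H.weingarten]; simp
  -- The Codazzi equation is the tangential part of this symmetry.
  have hsymm : pdV i (pdV j N) x = pdV j (pdV i N) x :=
    funext fun α => pd_comm (H.smooth_normal α) i j x
  rw [hd i, hd j] at hsymm
  have dd := fun i j =>
    H.pdV_tangent_comb (c := fun s y => -shapeOp Φ N g y s j) (a := fun _ => 0)
      (b := fun _ => 0) x i
      (fun s => smooth_differentiableAt (H.smooth_shapeOp s j).neg)
      (by fun_prop) (by fun_prop)
  rw [dd i j, dd j i, ← sub_eq_zero] at hsymm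
  have hneg : ∀ s i j, pd i (fun y => -shapeOp Φ N g y s j) x =
      -pd i (fun y => shapeOp Φ N g y s j) x := fun s i j => by
    simp [pd, fderiv_fun_neg]
  have h0 := H.tangent_coeff_eq_zero x (c := fun s => (-pd i (fun y => shapeOp Φ N g y s j) x
    - ∑ m, christoffel g x s i m * shapeOp Φ N g x m j)
    - (-pd j (fun y => shapeOp Φ N g y s i) x
    - ∑ m, christoffel g x s j m * shapeOp Φ N g x m i))
    (a := (0 + ∑ m, -shapeOp Φ N g x m j * g x i m) - (0 + ∑ m, -shapeOp Φ N g x m i * g x j m))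
    (b := (0 + ∑ m, -shapeOp Φ N g x m j * secondFF Φ N x i m)
      - (0 + ∑ m, -shapeOp Φ N g x m i * secondFF Φ N x j m))
    (by
      rw [← hsymm]
      simp only [hneg, pd_const, ite_self, zero_mul, mul_neg, Finset.sum_neg_distrib,
        Finset.sum_sub_distrib, sub_smul, add_smul, Finset.sum_add_distrib, neg_smul, zero_smul,
        Finset.sum_const_zero]
      abel)
  have h1 := congrFun h0 a
  simp only [Pi.zero_apply] at h1
  have h2 : ∑ m, shapeOp Φ N g x a m * christoffel g x m i j =
      ∑ m, shapeOp Φ N g x a m * christoffel g x m j i :=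
    Finset.sum_congr rfl fun m _ => by rw [H.christoffel_symm]
  simp only [covM, Matrix.add_apply, Matrix.sub_apply, Matrix.mul_apply, Matrix.of_apply, pdM, h2]
  linarith

theorem shapeOp_mul_inv_transpose (H : IsHyperboloidImmersion Φ N g) (x : E n) :
    (shapeOp Φ N g x * (g x)⁻¹).transpose = shapeOp Φ N g x * (g x)⁻¹ := by
  have h : (secondFF Φ N x).transpose = secondFF Φ N x := by ext i j; exact H.secondFF_symm x j i
  rw [shapeOp, Matrix.transpose_mul, Matrix.transpose_mul, H.inv_transpose, h, mul_assoc]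

/-- The Killing equation for the tangential part `ξ` of the linear Killing field `x ↦ L x` of
Minkowski space along the immersion. -/
theorem killing (H : IsHyperboloidImmersion Φ N g)
    (L : (Fin n ⊕ Fin 2 → ℝ) →ₗ[ℝ] (Fin n ⊕ Fin 2 → ℝ)) {ξ : Fin n → E n → ℝ} {ν : E n → ℝ}
    (hξ : ∀ p, ContDiff ℝ ∞ (ξ p)) (hν : ContDiff ℝ ∞ ν)
    (hdec : ∀ y, L (Φ y) = ∑ p, ξ p y • pdV p Φ y + ν y • N y) (x : E n) (i p : Fin n) :
    pd i (ξ p) x + ∑ a, christoffel g x p i a * ξ a x = ν x * shapeOp Φ N g x p i +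
      ((g x)⁻¹ * Matrix.of fun s i => mink (L (pdV i Φ x)) (pdV s Φ x)) p i := by
  have hLd : pdV i (fun y => L (Φ y)) x = L (pdV i Φ x) := by
    funext α
    have hl : ∀ u, L u α = ∑ β, L (fun j => if β = j then 1 else 0) α * u β := fun u => by
      have h := congrFun (LinearMap.pi_apply_eq_sum_univ L u) α
      simp only [Finset.sum_apply, Pi.smul_apply, smul_eq_mul] at h
      rw [h]
      exact Finset.sum_congr rfl fun β _ => by rw [mul_comm]
    change pd i (fun y => L (Φ y) α) x = _
    rw [funext fun y => hl (Φ y), hl (pdV i Φ x), pd_sum i fun β _ => (smooth_differentiableAt (H.smooth β)).const_mul _]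
    refine Finset.sum_congr rfl fun β _ => ?_
    rw [pd_mul i (by fun_prop) (smooth_differentiableAt (H.smooth β)), pd_const]
    simp [pdV]
  have hdec' : (fun y => L (Φ y)) =
      fun y => ∑ p, ξ p y • pdV p Φ y + (0 : ℝ) • Φ y + ν y • N y := by
    funext y; rw [hdec]; simp
  rw [hdec', H.pdV_tangent_comb (c := ξ) (a := fun _ => 0) (b := ν) x i
    (fun s => smooth_differentiableAt (hξ s)) (by fun_prop) (smooth_differentiableAt hν)] at hLd
  -- Differentiate `L Φ = ξ + ν N` and pair with the tangent vectors: what remains is `∇ξ - ν A`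
  -- with its index lowered.
  have h1 : ∀ q, mink (L (pdV i Φ x)) (pdV q Φ x) = ∑ s, g x q s *
      (pd i (ξ s) x + ∑ m, christoffel g x s i m * ξ m x - ν x * shapeOp Φ N g x s i) := fun q => by
    rw [← hLd, H.mink_tangent_comb]
    simp
  have h2 : (Matrix.of fun s i => mink (L (pdV i Φ x)) (pdV s Φ x)).col i =
      (g x).mulVec fun s => pd i (ξ s) x + ∑ m, christoffel g x s i m * ξ m x
        - ν x * shapeOp Φ N g x s i := by
    ext q
    simp [h1, Matrix.mulVec, dotProduct]
  have h3 := congrArg (fun v => (g x)⁻¹.mulVec v p) h2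
  simp only [Matrix.mulVec_mulVec, Matrix.nonsing_inv_mul _ (H.isUnit_det x),
    Matrix.one_mulVec] at h3
  rw [show ((g x)⁻¹ * Matrix.of fun s i => mink (L (pdV i Φ x)) (pdV s Φ x)) p i =
    (g x)⁻¹.mulVec ((Matrix.of fun s i => mink (L (pdV i Φ x)) (pdV s Φ x)).col i) p from rfl, h3]
  ring

/-- The divergence of the Newton flux of a linear Killing field. -/
theorem killing_flux_divergence (H : IsHyperboloidImmersion Φ N g)
    (L : (Fin n ⊕ Fin 2 → ℝ) →ₗ[ℝ] (Fin n ⊕ Fin 2 → ℝ))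
    (hL : ∀ u v, mink (L u) v = -mink (L v) u) {ξ : Fin n → E n → ℝ} {ν : E n → ℝ}
    (hξ : ∀ p, ContDiff ℝ ∞ (ξ p)) (hν : ContDiff ℝ ∞ ν)
    (hdec : ∀ y, L (Φ y) = ∑ p, ξ p y • pdV p Φ y + ν y • N y) (m : ℕ) (x : E n) :
    ∑ i, pd i (fun y => Real.sqrt (g y).det * ∑ p, newtonT m (shapeOp Φ N g y) i p * ξ p y) x =
      Real.sqrt (g x).det * ν x * newtonS (m + 1) (shapeOp Φ N g x) := by
  refine newton_flux_divergence (G := fun y => (g y)⁻¹) (Ω := Matrix.of fun s i =>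
    mink (L (pdV i Φ x)) (pdV s Φ x)) (fun i => Matrix.of fun a b => christoffel g x a i b)
    H.smooth_shapeOp ?_ (fun p => smooth_differentiableAt (hξ p))
    (fun i j p => H.christoffel_symm x p i j) (H.codazzi x) (fun i => ?_) (H.inv_transpose x)
    (H.shapeOp_mul_inv_transpose x) ?_ (H.killing L hξ hν hdec x) m
  · exact (smooth_differentiableAt (contDiff_matrix_det H.smooth_metric)).sqrt (H.det_pos x).ne'
  · exact pd_sqrt_det H.smooth_metric H.symm x (H.det_pos x) i
  · ext s i
    exact hL _ _

end IsHyperboloidImmersion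

end GaussCodazzi

/-! ### Curvature contractions as Newton tensors of the shape operator. -/

section CurvatureContractions

variable {n : ℕ}

theorem mixedDisc_const {ι : Type} [Fintype ι] [DecidableEq ι] (m : ℕ) (h : Fintype.card ι = m)
    (A : Matrix (Fin n) (Fin n) ℝ) : mixedDisc (fun _ : ι => A) = newtonS m A :=
  mixedDisc_comp_equiv (Fintype.equivFinOfCardEq h) fun _ : Fin m => A

theorem mixedDisc_update_of_card {ι : Type} [Fintype ι] [DecidableEq ι] (m : ℕ)
    (h : Fintype.card ι = m + 1) (A B : Matrix (Fin n) (Fin n) ℝ) (a : ι) :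
    mixedDisc (Function.update (fun _ : ι => A) a B) = (newtonT m A * B).trace := by
  let e := Fintype.equivFinOfCardEq h
  rw [← mixedDisc_update_const m A B (e a), ← mixedDisc_comp_equiv e]
  congr 1
  funext b
  by_cases hb : b = a
  · subst hb; simp
  · rw [Function.update_of_ne hb, Function.comp, Function.update_of_ne (e.injective.ne hb)]

/-- Contracting an alternating function of `J` with the `2 × 2` minors of a matrix. -/
theorem sum_alternating_mul_prod_minors {k : ℕ} (Ψ : (Fin k × Fin 2 → Fin n) → ℝ)
    (hΨ : ∀ (σ : Equiv.Perm (Fin k × Fin 2)) J,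
      Ψ (J ∘ σ) = ((Equiv.Perm.sign σ : ℤ) : ℝ) * Ψ J)
    (A : Matrix (Fin n) (Fin n) ℝ) (I : Fin k × Fin 2 → Fin n) :
    ∑ J, Ψ J * ∏ a, (A (J (a, 0)) (I (a, 0)) * A (J (a, 1)) (I (a, 1))
      - A (J (a, 1)) (I (a, 0)) * A (J (a, 0)) (I (a, 1))) =
    2 ^ k * ∑ J, Ψ J * ∏ α, A (J α) (I α) := by
  have h1 : ∀ (J : Fin k × Fin 2 → Fin n) a, A (J (a, 0)) (I (a, 0)) * A (J (a, 1)) (I (a, 1))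
      - A (J (a, 1)) (I (a, 0)) * A (J (a, 0)) (I (a, 1)) =
      ∑ π : Equiv.Perm (Fin 2), ((Equiv.Perm.sign π : ℤ) : ℝ) *
        ∏ c, A (J (a, π c)) (I (a, c)) := by
    intro J a
    have := Matrix.det_apply' (Matrix.of fun c d : Fin 2 => A (J (a, c)) (I (a, d)))
    rw [Matrix.det_fin_two] at this
    simp only [Matrix.of_apply] at this
    rw [← this]
    ring
  -- Expanding the product of minors gives the permutations of `Fin k × Fin 2` that preserve every
  -- pair, with their signs.
  have h2 : ∀ J : Fin k × Fin 2 → Fin n,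
      ∏ a, ∑ π : Equiv.Perm (Fin 2), ((Equiv.Perm.sign π : ℤ) : ℝ) *
        ∏ c, A (J (a, π c)) (I (a, c)) =
      ∑ p : Fin k → Equiv.Perm (Fin 2),
        ((Equiv.Perm.sign (Equiv.prodCongrRight p) : ℤ) : ℝ) *
          ∏ α, A ((J ∘ Equiv.prodCongrRight p) α) (I α) := by
    intro J
    rw [Finset.prod_univ_sum, Fintype.piFinset_univ]
    refine Finset.sum_congr rfl fun p _ => ?_
    rw [Finset.prod_mul_distrib, Equiv.Perm.sign_prodCongrRight, Fintype.prod_prod_type]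
    push_cast
    rfl
  simp only [h1, h2, Finset.mul_sum]
  rw [Finset.sum_comm]
  -- Reindexing `J` makes the sign from `Ψ` cancel the sign of the permutation, so all `2 ^ k` terms
  -- agree.
  have h3 : ∀ p : Fin k → Equiv.Perm (Fin 2),
      ∑ J : Fin k × Fin 2 → Fin n, Ψ J * (((Equiv.Perm.sign (Equiv.prodCongrRight p) : ℤ) : ℝ) *
          ∏ α, A ((J ∘ Equiv.prodCongrRight p) α) (I α)) = ∑ J, Ψ J * ∏ α, A (J α) (I α) := by
    intro p
    rw [← Equiv.sum_comp ((Equiv.prodCongrRight p).symm.arrowCongr (Equiv.refl (Fin n)))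
      (fun J => Ψ J * ∏ α, A (J α) (I α))]
    refine Finset.sum_congr rfl fun J _ => ?_
    have hJ : (Equiv.prodCongrRight p).symm.arrowCongr (Equiv.refl (Fin n)) J =
        J ∘ Equiv.prodCongrRight p := rfl
    rw [hJ, hΨ]
    ring
  simp only [h3, ← Finset.mul_sum]
  simp [Fintype.card_perm]

theorem gbCurv_eq_newtonS {Φ N : E n → Fin n ⊕ Fin 2 → ℝ} {g : Metric2 n}
    (H : IsHyperboloidImmersion Φ N g) (k : ℕ) (x : E n) :
    gbCurv k g x = newtonS (2 * k) (shapeOp Φ N g x) := by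
  rw [← mixedDisc_const (ι := Fin k × Fin 2) (2 * k) (by simp [mul_comm])]
  simp only [gbCurv, H.riemModUp_eq, mixedDisc]
  simp_rw [fun I => sum_alternating_mul_prod_minors (fun J => genDelta I J)
    (fun σ J => genDelta_comp_perm_right σ I J) (shapeOp Φ N g x) I, ← Finset.mul_sum]
  rw [← mul_assoc, one_div, inv_mul_cancel₀ (by positivity), one_mul]

/-- The `k - 1` curvature factors give `2^{k-1}` against the normalization `2^{-k}`, which leaves
`1/2`. -/
theorem gbP_eq {Φ N : E n → Fin n ⊕ Fin 2 → ℝ} {g : Metric2 n}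
    (H : IsHyperboloidImmersion Φ N g) (k : ℕ) (hk : 1 ≤ k) (x : E n) (s t j l : Fin n) :
    gbP k g x s t j l = (1 / 2) * ∑ I : Fin (k - 1) × Fin 2 → Fin n,
      ∑ J : Fin (k - 1) × Fin 2 → Fin n, ∑ p : Fin n, ∑ q : Fin n,
        genDelta (Sum.elim I ![s, t]) (Sum.elim J ![p, q])
        * (∏ α, shapeOp Φ N g x (J α) (I α)) * (g x)⁻¹ p j * (g x)⁻¹ q l := by
  have h : ∀ (I : Fin (k - 1) × Fin 2 → Fin n) p q, _ := fun I p q =>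
    sum_alternating_mul_prod_minors (fun J => genDelta (Sum.elim I ![s, t]) (Sum.elim J ![p, q]))
      (fun σ J => by
        have h1 := genDelta_comp_perm_right (σ.sumCongr (1 : Equiv.Perm (Fin 2)))
          (Sum.elim I ![s, t]) (Sum.elim J ![p, q])
        rw [Equiv.Perm.sign_sumCongr, Equiv.Perm.sign_one, mul_one] at h1
        rw [← h1]
        congr 1
        ext a; rcases a with a | a <;> simp) (shapeOp Φ N g x) I
  have e : ∀ F : (Fin (k - 1) × Fin 2 → Fin n) → Fin n → Fin n → ℝ,
      ∑ J, ∑ p, ∑ q, F J p q = ∑ p, ∑ q, ∑ J, F J p q := fun F => by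
    rw [Finset.sum_comm]
    exact Finset.sum_congr rfl fun p _ => Finset.sum_comm
  simp only [gbP, H.riemModUp_eq, e, ← Finset.sum_mul, h]
  simp only [mul_assoc, ← Finset.mul_sum]
  rw [← mul_assoc]
  congr 1
  obtain ⟨k, rfl⟩ : ∃ m, k = m + 1 := ⟨k - 1, by omega⟩
  simp only [Nat.add_sub_cancel, pow_succ]
  field_simp

/-- Exchanging the summed lower indices `p, q` changes the sign of the delta. This is what discards
the part of the mass density symmetric in its last two indices. -/
theorem gbP_antisymm {Φ N : E n → Fin n ⊕ Fin 2 → ℝ} {g : Metric2 n}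
    (H : IsHyperboloidImmersion Φ N g) (k : ℕ) (hk : 1 ≤ k) (x : E n) (s t j l : Fin n) :
    gbP k g x s t l j = -gbP k g x s t j l := by
  rw [gbP_eq H k hk, gbP_eq H k hk, ← mul_neg, ← Finset.sum_neg_distrib]
  congr 1
  refine Finset.sum_congr rfl fun I _ => ?_
  rw [← Finset.sum_neg_distrib]
  refine Finset.sum_congr rfl fun J _ => ?_
  rw [Finset.sum_comm, ← Finset.sum_neg_distrib]
  refine Finset.sum_congr rfl fun p _ => ?_
  rw [← Finset.sum_neg_distrib]
  refine Finset.sum_congr rfl fun q _ => ?_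
  have h1 := genDelta_comp_perm_right
    (Equiv.Perm.sumCongr (1 : Equiv.Perm (Fin (k - 1) × Fin 2)) (Equiv.swap (0 : Fin 2) 1))
      (Sum.elim I ![s, t]) (Sum.elim J ![p, q])
  rw [Equiv.Perm.sign_sumCongr, Equiv.Perm.sign_one, Equiv.Perm.sign_swap (by decide)] at h1
  have h2 : (Sum.elim J ![p, q] : (Fin (k - 1) × Fin 2) ⊕ Fin 2 → Fin n) ∘
      (Equiv.Perm.sumCongr (1 : Equiv.Perm (Fin (k - 1) × Fin 2)) (Equiv.swap (0 : Fin 2) 1)) =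
      Sum.elim J ![q, p] := by
    ext a
    rcases a with a | a
    · rfl
    · fin_cases a <;> simp
  rw [h2] at h1
  rw [h1]
  simp
  ring

/-- The contraction `u_s h_{jl} P^{ijsl}` is half of the Newton tensor of order `2k - 1` applied
to the vector `u`. -/
theorem gbP_contraction {Φ N : E n → Fin n ⊕ Fin 2 → ℝ} {g : Metric2 n}
    (H : IsHyperboloidImmersion Φ N g) (k : ℕ) (hk : 1 ≤ k) (x : E n) (u : Fin n → ℝ)
    (i : Fin n) :
    ∑ j, ∑ s, ∑ l, u s * secondFF Φ N x j l * gbP k g x i j s l =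
      (1 / 2) * ∑ p, newtonT (2 * k - 1) (shapeOp Φ N g x) i p * ∑ s, (g x)⁻¹ p s * u s := by
  set A := shapeOp Φ N g x with hA
  set w : Fin n → ℝ := fun p => ∑ s, (g x)⁻¹ p s * u s with hw
  -- The slot `Sum.inr 0` receives the matrix whose only nonzero column is `w` in position `i`,
  -- which pins one upper index to `i`. The other `2(k - 1) + 1 = 2k - 1` slots carry `A`.
  have hT : ∑ p, newtonT (2 * k - 1) A i p * w p =
      mixedDisc (Function.update (fun _ : (Fin (k - 1) × Fin 2) ⊕ Fin 2 => A) (Sum.inr 0)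
        (Matrix.of fun p i' => if i' = i then w p else 0)) := by
    rw [mixedDisc_update_of_card (2 * k - 1) (by simp; omega)]
    simp [Matrix.trace, Matrix.mul_apply]
  have hA' : ∀ q j, ∑ l, (g x)⁻¹ q l * secondFF Φ N x j l = A q j := fun q j => by
    simp only [hA, shapeOp, Matrix.mul_apply]
    exact Finset.sum_congr rfl fun l _ => by rw [H.secondFF_symm]
  rw [hT]
  simp only [mixedDisc]
  have hsum : ∀ F : ((Fin (k - 1) × Fin 2) ⊕ Fin 2 → Fin n) → ℝ,
      ∑ I, F I = ∑ I, ∑ a, ∑ b, F (Sum.elim I ![a, b]) := fun F => by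
    rw [← (Equiv.sumArrowEquivProdArrow _ _ _).symm.sum_comp, Fintype.sum_prod_type]
    refine Finset.sum_congr rfl fun I _ => ?_
    rw [← (finTwoArrowEquiv (Fin n)).symm.sum_comp, Fintype.sum_prod_type]
    rfl
  simp only [hsum]
  simp only [Fintype.prod_sum_type, Fin.prod_univ_two, Sum.elim_inl, Sum.elim_inr,
    Matrix.cons_val_zero, Matrix.cons_val_one, Function.update_self, Matrix.of_apply]
  simp only [ne_eq, reduceCtorEq, not_false_eq_true, Function.update_of_ne, Sum.inr.injEq,
    one_ne_zero, gbP_eq H k hk, ← hA]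
  have comm2 : ∀ {K : Type} [Fintype K] (F : Fin n → Fin n → K → ℝ),
      ∑ s, ∑ l, ∑ z, F s l z = ∑ z, ∑ s, ∑ l, F s l z := fun F => by
    conv_rhs => rw [Finset.sum_comm]
    exact Finset.sum_congr rfl fun s _ => Finset.sum_comm
  have hR : ∀ F : Fin n → Fin n → (Fin (k - 1) × Fin 2 → Fin n) → Fin n → Fin n → ℝ,
      ∀ G : (Fin (k - 1) × Fin 2 → Fin n) → Fin n → Fin n → Fin n → ℝ,
      ∑ i', ∑ j, ∑ J, ∑ p, ∑ q, F i' j J p q * (G J p q j * ((if i' = i then w p else 0) * A q j)) =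
      ∑ j, ∑ J, ∑ p, ∑ q, F i j J p q * (G J p q j * (w p * A q j)) := fun F G => by
    rw [Finset.sum_eq_single i (fun i' _ h => by simp [h]) (by simp)]
    simp
  simp only [hR fun i' j J p q => genDelta (Sum.elim _ ![i', j]) (Sum.elim J ![p, q])]
  rw [Finset.sum_comm (s := (Finset.univ : Finset (Fin (k - 1) × Fin 2 → Fin n))), Finset.mul_sum]
  refine Finset.sum_congr rfl fun j _ => ?_
  have hwA : ∀ p q, w p * A q j = ∑ s, ∑ l, (g x)⁻¹ p s * u s *
      ((g x)⁻¹ q l * secondFF Φ N x j l) := fun p q => by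
    rw [← hA', hw, Finset.sum_mul_sum]
  simp only [hwA, Finset.mul_sum]
  rw [comm2]
  refine Finset.sum_congr rfl fun I _ => ?_
  rw [comm2]
  refine Finset.sum_congr rfl fun J _ => ?_
  rw [comm2]
  refine Finset.sum_congr rfl fun p _ => ?_
  rw [comm2]
  refine Finset.sum_congr rfl fun q _ => Finset.sum_congr rfl fun s _ =>
    Finset.sum_congr rfl fun l _ => ?_
  ring

end CurvatureContractions

/-! ### The hyperbolic metric and the graph volume density in the chart. -/

section HyperbolicChart

variable {n : ℕ}

theorem V0_eq_sqrt (x : E n) : V0 x = Real.sqrt (1 + ‖x‖ ^ 2) := by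
  rw [V0, hypDist, Real.cosh_arsinh]

theorem V0_pos (x : E n) : 0 < V0 x := Real.cosh_pos _

theorem norm_sq_eq_sum (x : E n) : ‖x‖ ^ 2 = ∑ i, x i * x i := by
  rw [EuclideanSpace.real_norm_sq_eq]
  exact Finset.sum_congr rfl fun i _ => sq _

theorem V0_sq (x : E n) : V0 x ^ 2 = 1 + ‖x‖ ^ 2 := by
  rw [V0_eq_sqrt, Real.sq_sqrt (by positivity)]

theorem sum_coord_sq (x : E n) : ∑ i, x i * x i = V0 x ^ 2 - 1 := by
  rw [V0_sq, norm_sq_eq_sum]; ring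

theorem contDiff_V0 : ContDiff ℝ ∞ (V0 : E n → ℝ) := by
  have h : (V0 : E n → ℝ) = fun x => Real.sqrt (1 + ‖x‖ ^ 2) := funext V0_eq_sqrt
  rw [h]
  exact (contDiff_const.add (contDiff_norm_sq ℝ)).sqrt fun x => by positivity

theorem pd_V0 (i : Fin n) (x : E n) : pd i V0 x = x i / V0 x := by
  have hd := smooth_differentiableAt (x := x) (contDiff_V0 (n := n))
  have h1 : (fun y : E n => V0 y * V0 y) = fun y => 1 + ∑ j, y j * y j := by
    funext y; rw [sum_coord_sq]; ring
  have h2 := pd_mul i hd hd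
  have hc : ∀ j, DifferentiableAt ℝ (fun y : E n => y j) x :=
    fun j => smooth_differentiableAt (contDiff_coord j)
  rw [h1, pd_add i (by fun_prop) (DifferentiableAt.fun_sum fun j _ => (hc j).fun_mul (hc j)),
    pd_const, pd_sum i fun j _ => (hc j).fun_mul (hc j)] at h2
  simp only [pd_mul i (hc _) (hc _), pd_coord] at h2
  have h3 : ∑ j, ((if i = j then (1 : ℝ) else 0) * x j + x j * if i = j then 1 else 0) =
      x i + x i := by simp [Finset.sum_add_distrib]
  rw [h3] at h2
  have := (V0_pos x).ne'
  field_simp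
  linarith

theorem hypMetric_apply (x : E n) (i j : Fin n) :
    hypMetric n x i j = (if i = j then 1 else 0) - pd i V0 x * pd j V0 x := by
  have := (V0_pos x).ne'
  rw [pd_V0, pd_V0, hypMetric, Matrix.of_apply, ← V0_sq]
  field_simp

theorem hypMetric_symm (x : E n) (i j : Fin n) : hypMetric n x i j = hypMetric n x j i := by
  rw [hypMetric_apply, hypMetric_apply, mul_comm, eq_comm]
  simp [eq_comm]

theorem pd_pd_V0 (i j : Fin n) (x : E n) : pd i (pd j V0) x = hypMetric n x i j / V0 x := by
  have h : ∀ y : E n, pd j V0 y * V0 y = y j := fun y => by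
    rw [pd_V0]; field_simp [(V0_pos y).ne']
  have h1 := pd_mul i (smooth_differentiableAt (x := x) (contDiff_pd contDiff_V0 j))
    (smooth_differentiableAt (x := x) contDiff_V0)
  rw [funext h, pd_coord] at h1
  rw [hypMetric_apply, h1]
  have := (V0_pos x).ne'
  field_simp
  ring

theorem hypMetric_inv (x : E n) :
    (hypMetric n x)⁻¹ = Matrix.of fun i j => (if i = j then 1 else 0) + x i * x j := by
  refine Matrix.inv_eq_right_inv ?_
  ext i k
  have hV := (V0_pos x).ne'
  have e : ∀ j, (hypMetric n x i j) * ((if j = k then 1 else 0) + x j * x k) =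
      (if i = j then if j = k then 1 else 0 else 0) + (if i = j then x j * x k else 0)
      - (if j = k then x i * x j / V0 x ^ 2 else 0) - x i * x k / V0 x ^ 2 * (x j * x j) := by
    intro j
    rw [hypMetric, Matrix.of_apply, ← V0_sq]
    split_ifs <;> ring
  simp only [Matrix.mul_apply, Matrix.of_apply, e, Finset.sum_sub_distrib, Finset.sum_add_distrib,
    Finset.sum_ite_eq, Finset.sum_ite_eq', Finset.mem_univ, if_true, ← Finset.mul_sum,
    sum_coord_sq, Matrix.one_apply]
  field_simp
  ring

theorem hypMetric_det (x : E n) : (hypMetric n x).det = 1 / V0 x ^ 2 := by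
  have h : hypMetric n x = 1 + Matrix.replicateCol Unit (fun i => -x i / V0 x ^ 2) *
      Matrix.replicateRow Unit (fun i => x i) := by
    ext i j
    rw [hypMetric, Matrix.of_apply, ← V0_sq]
    simp [Matrix.mul_apply, Matrix.one_apply]
    ring
  rw [h, Matrix.det_one_add_replicateCol_mul_replicateRow]
  have hV := (V0_pos x).ne'
  have : (fun i => x i) ⬝ᵥ (fun i => -x i / V0 x ^ 2) = -(1 / V0 x ^ 2) * (V0 x ^ 2 - 1) := by
    rw [← sum_coord_sq, dotProduct, Finset.mul_sum]
    exact Finset.sum_congr rfl fun i _ => by ring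
  rw [this]
  field_simp
  ring

/-- The radial derivative `∑ xⁱ ∂ᵢ f`. -/
def radialDeriv (f : E n → ℝ) (x : E n) : ℝ := ∑ i, x i * pd i f x

theorem gradSq_eq (f : E n → ℝ) (x : E n) :
    gradSq f x = ∑ i, pd i f x * pd i f x + radialDeriv f x ^ 2 := by
  simp only [gradSq, hypMetric_inv, Matrix.of_apply, add_mul, Finset.sum_add_distrib, ite_mul,
    one_mul, zero_mul, Finset.sum_ite_eq, Finset.mem_univ, if_true, radialDeriv, sq,
    Finset.sum_mul_sum]
  congr 1
  exact Finset.sum_congr rfl fun i _ => Finset.sum_congr rfl fun j _ => by ring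

theorem gradSq_nonneg (f : E n → ℝ) (x : E n) : 0 ≤ gradSq f x := by
  rw [gradSq_eq]
  exact add_nonneg (Finset.sum_nonneg fun i _ => mul_self_nonneg _) (sq_nonneg _)

/-- The factor `W = √(1 + V² |∇̄f|²)`. -/
def graphFactor (f : E n → ℝ) (x : E n) : ℝ := Real.sqrt (1 + V0 x ^ 2 * gradSq f x)

theorem one_add_pos (f : E n → ℝ) (x : E n) : 0 < 1 + V0 x ^ 2 * gradSq f x := by
  have := gradSq_nonneg f x
  positivity

theorem graphFactor_pos (f : E n → ℝ) (x : E n) : 0 < graphFactor f x :=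
  Real.sqrt_pos.2 (one_add_pos f x)

theorem graphFactor_sq (f : E n → ℝ) (x : E n) :
    graphFactor f x ^ 2 = 1 + V0 x ^ 2 * gradSq f x :=
  Real.sq_sqrt (one_add_pos f x).le

theorem contDiff_radialDeriv {f : E n → ℝ} (hf : ContDiff ℝ ∞ f) :
    ContDiff ℝ ∞ (radialDeriv f) :=
  ContDiff.sum fun i _ => (contDiff_coord i).mul (contDiff_pd hf i)

theorem contDiff_graphFactor {f : E n → ℝ} (hf : ContDiff ℝ ∞ f) :
    ContDiff ℝ ∞ (graphFactor f) := by
  refine ContDiff.sqrt ?_ fun x => (one_add_pos f x).ne'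
  simp_rw [gradSq_eq]
  exact contDiff_const.add ((contDiff_V0.pow 2).mul ((ContDiff.sum fun i _ =>
    (contDiff_pd hf i).mul (contDiff_pd hf i)).add ((contDiff_radialDeriv hf).pow 2)))

/-- The graph metric is a rank one perturbation of `b`, which multiplies `det b = 1/V²` by `1 +
V²|∇̄f|²`. -/
theorem graphMetric_det (f : E n → ℝ) (x : E n) :
    (graphMetric f x).det = (graphFactor f x / V0 x) ^ 2 := by
  have h : graphMetric f x = hypMetric n x + Matrix.replicateCol Unit (fun i => V0 x ^ 2 * pd i f x) *
      Matrix.replicateRow Unit (fun i => pd i f x) := by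
    ext i j
    simp [graphMetric, Matrix.mul_apply]
  have hV := (V0_pos x).ne'
  have hu : IsUnit (hypMetric n x).det := by
    rw [hypMetric_det]; exact (by positivity : (1 / V0 x ^ 2) ≠ 0).isUnit
  rw [h, Matrix.det_add_replicateCol_mul_replicateRow hu, hypMetric_det, div_pow, graphFactor_sq]
  have h2 : (1 + Matrix.replicateRow Unit (fun i => pd i f x) * (hypMetric n x)⁻¹ *
      Matrix.replicateCol Unit (fun i => V0 x ^ 2 * pd i f x)).det = 1 + V0 x ^ 2 * gradSq f x := by
    rw [Matrix.det_unique]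
    simp only [Matrix.add_apply, Matrix.one_apply_eq, Matrix.mul_apply,
      Matrix.replicateRow_apply, Matrix.replicateCol_apply, gradSq, Finset.mul_sum, Finset.sum_mul]
    rw [Finset.sum_comm]
    congr 1
    exact Finset.sum_congr rfl fun i _ => Finset.sum_congr rfl fun j _ => by ring
  rw [h2]
  ring

theorem sqrt_graphMetric_det (f : E n → ℝ) (x : E n) :
    Real.sqrt (graphMetric f x).det = graphFactor f x / V0 x := by
  rw [graphMetric_det, Real.sqrt_sq (div_nonneg (graphFactor_pos f x).le (V0_pos x).le)]

end HyperbolicChart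

/-! ### The graph as a hypersurface of the hyperboloid and its Newton flux. -/

section GraphImmersion

variable {n : ℕ}

/-- The vector of Minkowski space with the spacelike part `a` whose remaining part is
`α (cosh t, sinh t) + β (sinh t, cosh t)`. -/
def frameVec (t : ℝ) (a : Fin n → ℝ) (α β : ℝ) : Fin n ⊕ Fin 2 → ℝ :=
  Sum.elim a ![α * Real.cosh t + β * Real.sinh t, α * Real.sinh t + β * Real.cosh t]

/-- Hyperbolic rotation by `t` is a Minkowski isometry, so `t` disappears. -/
theorem mink_frameVec (t : ℝ) (a a' : Fin n → ℝ) (α β α' β' : ℝ) :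
    mink (frameVec t a α β) (frameVec t a' α' β') = ∑ i, a i * a' i - α * α' + β * β' := by
  simp only [mink, frameVec, minkSign, Fintype.sum_sum_type, Sum.elim_inl, Sum.elim_inr,
    Fin.sum_univ_two, Matrix.cons_val_zero, Matrix.cons_val_one, one_mul]
  linear_combination (β * β' - α * α') * Real.cosh_sq t

/-- Differentiating the rotating frame interchanges its last two vectors, hence the cross terms
between `α` and `β`. -/
theorem pdV_frameVec {t α β : E n → ℝ} {a : Fin n → E n → ℝ} {x : E n} (i : Fin n)
    (ht : DifferentiableAt ℝ t x) (hα : DifferentiableAt ℝ α x) (hβ : DifferentiableAt ℝ β x) :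
    pdV i (fun y => frameVec (t y) (fun j => a j y) (α y) (β y)) x =
      frameVec (t x) (fun j => pd i (a j) x) (pd i α x + β x * pd i t x)
        (pd i β x + α x * pd i t x) := by
  have hc : pd i (fun y => Real.cosh (t y)) x = Real.sinh (t x) * pd i t x :=
    pd_comp i (Real.hasDerivAt_cosh _) ht
  have hs : pd i (fun y => Real.sinh (t y)) x = Real.cosh (t x) * pd i t x :=
    pd_comp i (Real.hasDerivAt_sinh _) ht
  funext γ
  rcases γ with j | γ
  · rfl
  · fin_cases γ
    · change pd i (fun y => α y * Real.cosh (t y) + β y * Real.sinh (t y)) x = _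
      rw [pd_add i (hα.fun_mul ht.cosh) (hβ.fun_mul ht.sinh), pd_mul i hα ht.cosh,
        pd_mul i hβ ht.sinh, hc, hs]
      simp [frameVec]
      ring
    · change pd i (fun y => α y * Real.sinh (t y) + β y * Real.cosh (t y)) x = _
      rw [pd_add i (hα.fun_mul ht.sinh) (hβ.fun_mul ht.cosh), pd_mul i hα ht.sinh,
        pd_mul i hβ ht.cosh, hc, hs]
      simp [frameVec]
      ring

theorem contDiff_frameVec {t α β : E n → ℝ} {a : Fin n → E n → ℝ}
    (ht : ContDiff ℝ ∞ t) (ha : ∀ j, ContDiff ℝ ∞ (a j)) (hα : ContDiff ℝ ∞ α)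
    (hβ : ContDiff ℝ ∞ β) (γ : Fin n ⊕ Fin 2) :
    ContDiff ℝ ∞ fun y => frameVec (t y) (fun j => a j y) (α y) (β y) γ := by
  have hc := Real.contDiff_cosh.comp ht
  have hs := Real.contDiff_sinh.comp ht
  rcases γ with j | γ
  · exact ha j
  · fin_cases γ
    · exact (hα.mul hc).add (hβ.mul hs)
    · exact (hα.mul hs).add (hβ.mul hc)

/-- The graph of `f` as a hypersurface in the hyperboloid of dimension `n + 1`. -/
def graphPosition (f : E n → ℝ) (x : E n) : Fin n ⊕ Fin 2 → ℝ :=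
  frameVec (f x) (fun i => x i) (V0 x) 0

/-- The unit normal of the graph of `f`. -/
def graphNormal (f : E n → ℝ) (x : E n) : Fin n ⊕ Fin 2 → ℝ :=
  frameVec (f x) (fun i => -(V0 x / graphFactor f x) * (pd i f x + x i * radialDeriv f x))
    (-(V0 x / graphFactor f x) * (V0 x * radialDeriv f x)) (graphFactor f x)⁻¹

theorem graphMetric_apply (f : E n → ℝ) (x : E n) (i j : Fin n) :
    graphMetric f x i j = hypMetric n x i j + V0 x ^ 2 * pd i f x * pd j f x := rfl

variable {f : E n → ℝ}

theorem pdV_graphPosition (hf : ContDiff ℝ ∞ f) (x : E n) (i : Fin n) :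
    pdV i (graphPosition f) x =
      frameVec (f x) (fun j => if i = j then 1 else 0) (pd i V0 x) (V0 x * pd i f x) := by
  have h := pdV_frameVec (x := x) (t := f) (a := fun j y => y j) (α := V0) (β := fun _ => 0) i
    (smooth_differentiableAt hf)
    (smooth_differentiableAt contDiff_V0) (by fun_prop)
  simp only [pd_const, pd_coord, zero_mul, add_zero, zero_add] at h
  exact h

theorem pdV_pdV_graphPosition (hf : ContDiff ℝ ∞ f) (x : E n) (i j : Fin n) :
    pdV i (pdV j (graphPosition f)) x = frameVec (f x) 0
      (pd i (pd j V0) x + V0 x * pd i f x * pd j f x)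
      (pd i V0 x * pd j f x + pd j V0 x * pd i f x + V0 x * pd i (pd j f) x) := by
  have hVj := smooth_differentiableAt (x := x) (contDiff_pd (contDiff_V0 (n := n)) j)
  have hfj := smooth_differentiableAt (x := x) (contDiff_pd hf j)
  have hV := smooth_differentiableAt (x := x) (contDiff_V0 (n := n))
  have h := pdV_frameVec (x := x) (t := f) (a := fun l _ => if j = l then 1 else 0)
    (α := pd j V0) (β := fun y => V0 y * pd j f y) i
    (smooth_differentiableAt hf) hVj (hV.fun_mul hfj)
  rw [show pdV j (graphPosition f) = fun y => frameVec (f y) (fun l => if j = l then 1 else 0)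
    (pd j V0 y) (V0 y * pd j f y) from funext fun y => pdV_graphPosition hf y j, h,
    pd_mul i hV hfj]
  simp only [pd_const]
  congr 1 <;> ring

theorem sum_coord_mul_pd (f : E n → ℝ) (x : E n) : ∑ i, x i * pd i f x = radialDeriv f x := rfl

/-- The normal is `W⁻¹(V⁻¹ ∂_s - V ∇̄f)`: in the chart `∇̄f` has components `∂_i f + xⁱ radialDeriv
f`, and its `α`-component `dV(∇̄f)` is `V radialDeriv f`. -/
theorem isHyperboloidImmersion_graph (hf : ContDiff ℝ ∞ f) :
    IsHyperboloidImmersion (graphPosition f) (graphNormal f) (graphMetric f) where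
  smooth := contDiff_frameVec hf contDiff_coord contDiff_V0 contDiff_const
  smooth_normal := by
    have hW := contDiff_graphFactor hf
    have hq := contDiff_radialDeriv hf
    have hVW : ContDiff ℝ ∞ fun y => -(V0 y / graphFactor f y) :=
      (contDiff_V0.div hW fun y => (graphFactor_pos f y).ne').neg
    exact contDiff_frameVec hf (fun i => hVW.mul ((contDiff_pd hf i).add ((contDiff_coord i).mul hq)))
      (hVW.mul (contDiff_V0.mul hq)) (hW.inv fun y => (graphFactor_pos f y).ne')
  norm x := by
    rw [graphPosition, mink_frameVec, sum_coord_sq]; ring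
  norm_normal x := by
    have hV := (V0_pos x).ne'
    have hW := (graphFactor_pos f x).ne'
    have hW2 := graphFactor_sq f x
    have hg := gradSq_eq f x
    have e : ∑ i, -(V0 x / graphFactor f x) * (pd i f x + x i * radialDeriv f x) *
        (-(V0 x / graphFactor f x) * (pd i f x + x i * radialDeriv f x)) =
        (V0 x / graphFactor f x) ^ 2 * (∑ i, pd i f x * pd i f x
          + 2 * radialDeriv f x * ∑ i, x i * pd i f x
          + radialDeriv f x ^ 2 * ∑ i, x i * x i) := by
      simp only [mul_add, Finset.mul_sum, ← Finset.sum_add_distrib]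
      exact Finset.sum_congr rfl fun i _ => by ring
    rw [sum_coord_mul_pd, sum_coord_sq] at e
    rw [graphNormal, mink_frameVec, e]
    field_simp
    rw [hW2, hg]
    ring_nf
  orth x := by
    have e : ∑ i, x i * (-(V0 x / graphFactor f x) * (pd i f x + x i * radialDeriv f x)) =
        -(V0 x / graphFactor f x) * (∑ i, x i * pd i f x + radialDeriv f x * ∑ i, x i * x i) := by
      simp only [mul_add, Finset.mul_sum, ← Finset.sum_add_distrib]
      exact Finset.sum_congr rfl fun i _ => by ring
    rw [sum_coord_mul_pd, sum_coord_sq] at e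
    rw [graphPosition, graphNormal, mink_frameVec, e]
    ring
  orth_tangent x i := by
    have hV := (V0_pos x).ne'
    have hW := (graphFactor_pos f x).ne'
    rw [pdV_graphPosition hf, graphNormal, mink_frameVec, pd_V0]
    simp only [ite_mul, one_mul, zero_mul, Finset.sum_ite_eq, Finset.mem_univ, if_true]
    field_simp
    ring
  metric x i j := by
    rw [pdV_graphPosition hf, pdV_graphPosition hf, mink_frameVec, graphMetric_apply,
      hypMetric_apply]
    simp only [ite_mul, one_mul, zero_mul, Finset.sum_ite_eq, Finset.mem_univ, if_true,
      eq_comm (a := j)]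
    ring
  det_pos x := by
    rw [graphMetric_det]
    have := graphFactor_pos f x
    have := V0_pos x
    positivity

/-- Since `∇̄²f = ∂²f + radialDeriv f · b` and `⟨∇̄V, ∇̄f⟩ = V radialDeriv f`, the right side is
`V∇̄²f + dV⊗df + df⊗dV + V²⟨∇̄V, ∇̄f⟩ df⊗df`. -/
theorem graph_secondFF (hf : ContDiff ℝ ∞ f) (x : E n) (i j : Fin n) :
    graphFactor f x * secondFF (graphPosition f) (graphNormal f) x i j =
      V0 x * radialDeriv f x * hypMetric n x i j + V0 x ^ 3 * radialDeriv f x * pd i f x * pd j f x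
      + pd i V0 x * pd j f x + pd j V0 x * pd i f x + V0 x * pd i (pd j f) x := by
  have hV := (V0_pos x).ne'
  have hW := (graphFactor_pos f x).ne'
  rw [secondFF, Matrix.of_apply, pdV_pdV_graphPosition hf, graphNormal, mink_frameVec, pd_pd_V0]
  simp only [Pi.zero_apply, zero_mul, Finset.sum_const_zero]
  field_simp
  ring

/-- The infinitesimal boost in the plane of the last two coordinates. -/
def boost : (Fin n ⊕ Fin 2 → ℝ) →ₗ[ℝ] (Fin n ⊕ Fin 2 → ℝ) where
  toFun u := Sum.elim (fun _ => 0) ![u (Sum.inr 1), u (Sum.inr 0)]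
  map_add' u v := by
    ext γ
    rcases γ with j | γ
    · simp
    · fin_cases γ <;> simp
  map_smul' c u := by
    ext γ
    rcases γ with j | γ
    · simp
    · fin_cases γ <;> simp

theorem boost_skew (u v : Fin n ⊕ Fin 2 → ℝ) : mink (boost u) v = -mink (boost v) u := by
  simp [mink, boost, minkSign, Fintype.sum_sum_type]
  ring

theorem boost_frameVec (t : ℝ) (a : Fin n → ℝ) (α β : ℝ) :
    boost (frameVec t a α β) = frameVec t 0 β α := by
  ext γ
  rcases γ with j | γ
  · rfl
  · fin_cases γ
    · simp [boost, frameVec]; ring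
    · simp [boost, frameVec]; ring

/-- The tangential part `V² g^{ps} ∂_s f` of the vertical Killing field along the graph. -/
def graphKilling (f : E n → ℝ) (p : Fin n) (x : E n) : ℝ :=
  ∑ s, (graphMetric f x)⁻¹ p s * (V0 x ^ 2 * pd s f x)

theorem contDiff_graphKilling (hf : ContDiff ℝ ∞ f) (p : Fin n) :
    ContDiff ℝ ∞ (graphKilling f p) :=
  ContDiff.sum fun s _ => ((isHyperboloidImmersion_graph hf).smooth_inv p s).mul
    ((contDiff_V0.pow 2).mul (contDiff_pd hf s))

/-- The boost at the graph is `∂_s`. Its products with the frame are `V² ∂_l f` on tangent vectors,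
`0` on the position and `V/W` on the normal. -/
theorem boost_graphPosition (hf : ContDiff ℝ ∞ f) (x : E n) :
    boost (graphPosition f x) = ∑ p, graphKilling f p x • pdV p (graphPosition f) x
      + (V0 x / graphFactor f x) • graphNormal f x := by
  have h0 : boost (graphPosition f x) = frameVec (f x) 0 0 (V0 x) := boost_frameVec _ _ _ _
  have h1 : mink (boost (graphPosition f x)) (graphPosition f x) = 0 := by
    rw [h0, graphPosition, mink_frameVec]; simp
  have h2 : mink (boost (graphPosition f x)) (graphNormal f x) = V0 x / graphFactor f x := by
    rw [h0, graphNormal, mink_frameVec]; simp [div_eq_mul_inv]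
  have h3 : ∀ l, mink (boost (graphPosition f x)) (pdV l (graphPosition f) x) =
      V0 x ^ 2 * pd l f x := fun l => by
    rw [h0, pdV_graphPosition hf, mink_frameVec]; simp; ring
  conv_lhs => rw [(isHyperboloidImmersion_graph hf).decompose x (boost (graphPosition f x))]
  simp only [h1, h2, h3, zero_smul, sub_zero]
  rfl

/-- The flux field `Y^i = ½ √(det g) T^i_p ξ^p` of the mass formula. -/
def graphFlux (k : ℕ) (f : E n → ℝ) (i : Fin n) (x : E n) : ℝ :=
  (1 / 2) * (Real.sqrt (graphMetric f x).det * ∑ p,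
    newtonT (2 * k - 1) (shapeOp (graphPosition f) (graphNormal f) (graphMetric f) x) i p *
      graphKilling f p x)

theorem contDiff_graphFlux (k : ℕ) (hf : ContDiff ℝ ∞ f) (i : Fin n) :
    ContDiff ℝ ∞ (graphFlux k f i) := by
  have H := isHyperboloidImmersion_graph hf
  refine contDiff_const.mul (ContDiff.mul ?_ (ContDiff.sum fun p _ =>
    (contDiff_newtonT _ H.smooth_shapeOp i p).mul (contDiff_graphKilling hf p)))
  exact (contDiff_matrix_det H.smooth_metric).sqrt fun x => (H.det_pos x).ne'

/-- The weight in `killing_flux_divergence` is `√det g · ν = (W/V)(V/W) = 1`, so no weight remains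
on `L̃_k`. -/
theorem graphFlux_divergence (k : ℕ) (hk : 1 ≤ k) (hf : ContDiff ℝ ∞ f) (x : E n) :
    ∑ i, pd i (graphFlux k f i) x = (1 / 2) * gbCurv k (graphMetric f) x := by
  have H := isHyperboloidImmersion_graph hf
  have hν : ContDiff ℝ ∞ fun y => V0 y / graphFactor f y :=
    contDiff_V0.div (contDiff_graphFactor hf) fun y => (graphFactor_pos f y).ne'
  have h := H.killing_flux_divergence boost boost_skew (contDiff_graphKilling hf) hν
    (boost_graphPosition hf) (2 * k - 1) x
  have hd : ∀ i, pd i (graphFlux k f i) x = (1 / 2) * pd i (fun y =>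
      Real.sqrt (graphMetric f y).det * ∑ p, newtonT (2 * k - 1)
        (shapeOp (graphPosition f) (graphNormal f) (graphMetric f) y) i p *
          graphKilling f p y) x := fun i => by
    have hdiff : ContDiff ℝ ∞ fun y => Real.sqrt (graphMetric f y).det * ∑ p, newtonT (2 * k - 1)
        (shapeOp (graphPosition f) (graphNormal f) (graphMetric f) y) i p *
          graphKilling f p y :=
      ((contDiff_matrix_det H.smooth_metric).sqrt fun x => (H.det_pos x).ne').mul
        (ContDiff.sum fun p _ => (contDiff_newtonT _ H.smooth_shapeOp i p).mul
          (contDiff_graphKilling hf p))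
    unfold graphFlux
    rw [pd_mul i (by fun_prop) (smooth_differentiableAt hdiff), pd_const]
    ring
  simp only [hd, ← Finset.mul_sum, h]
  rw [gbCurv_eq_newtonS H, sqrt_graphMetric_det, show 2 * k - 1 + 1 = 2 * k by omega]
  have hV := (V0_pos x).ne'
  have hW := (graphFactor_pos f x).ne'
  field_simp

end GraphImmersion

/-! ### The mass density as the normal component of the flux. -/

section MassDensity

variable {n : ℕ}

/-- This makes `b` itself an induced metric, so the immersion formulas compute its Christoffel
symbols. -/
theorem graphMetric_zero : graphMetric (fun _ : E n => 0) = hypMetric n := by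
  funext x
  ext i j
  rw [graphMetric_apply, pd_const]
  ring

theorem christoffel_hypMetric (x : E n) (s i j : Fin n) :
    christoffel (hypMetric n) x s i j = -(hypMetric n x i j) * x s := by
  have hf : ContDiff ℝ ∞ (fun _ : E n => (0 : ℝ)) := contDiff_const
  have H := isHyperboloidImmersion_graph hf
  have h := H.christoffel_eq x s i j
  rw [graphMetric_zero] at h
  rw [h]
  have hV := (V0_pos x).ne'
  have e : ∀ l, mink (pdV i (pdV j (graphPosition fun _ : E n => 0)) x)
      (pdV l (graphPosition fun _ : E n => 0) x) = -(hypMetric n x i j / V0 x) * (x l / V0 x) := by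
    intro l
    rw [pdV_pdV_graphPosition hf, pdV_graphPosition hf, mink_frameVec, pd_pd_V0, pd_V0]
    simp [pd_const]
  have e2 : ∀ l, (hypMetric n x)⁻¹ s l * (-(hypMetric n x i j / V0 x) * (x l / V0 x)) =
      -(hypMetric n x i j / V0 x ^ 2) * ((if s = l then x l else 0) + x s * (x l * x l)) := by
    intro l
    rw [hypMetric_inv, Matrix.of_apply]
    split_ifs
    · field_simp
    · field_simp
      ring
  simp only [e, e2, ← Finset.mul_sum, Finset.sum_add_distrib, Finset.sum_ite_eq, Finset.mem_univ,
    if_true, sum_coord_sq]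
  field_simp
  ring

theorem covDeriv_twoTensor (T : Metric2 n) (x : E n) (l j s : Fin n) :
    covDeriv (hypMetric n) (twoTensor T) x ![l, j, s] = pd l (fun y => T y j s) x
      + hypMetric n x l j * ∑ p, x p * T x p s + hypMetric n x l s * ∑ p, x p * T x j p := by
  have h0 : ∀ p, Function.update (Fin.tail ![l, j, s]) 0 p = ![p, s] := fun p => by
    ext a; fin_cases a <;> simp
  have h1 : ∀ p, Function.update (Fin.tail ![l, j, s]) 1 p = ![j, p] := fun p => by
    ext a; fin_cases a <;> simp
  simp only [covDeriv, Fin.sum_univ_two, h0, h1, twoTensor, christoffel_hypMetric]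
  simp [Fin.tail, Finset.mul_sum, mul_assoc]
  ring

theorem covDeriv_twoTensor_graph {f : E n → ℝ} (hf : ContDiff ℝ ∞ f) (x : E n) (l j s : Fin n) :
    covDeriv (hypMetric n) (twoTensor (graphMetric f - hypMetric n)) x ![l, j, s] =
      2 * V0 x * pd l V0 x * pd j f x * pd s f x
      + V0 x ^ 2 * (pd l (pd j f) x + hypMetric n x l j * radialDeriv f x) * pd s f x
      + V0 x ^ 2 * pd j f x * (pd l (pd s f) x + hypMetric n x l s * radialDeriv f x) := by
  have he : ∀ (y : E n) a b, (graphMetric f - hypMetric n) y a b =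
      V0 y * V0 y * pd a f y * pd b f y := fun y a b => by
    rw [Pi.sub_apply, Matrix.sub_apply, graphMetric_apply]; ring
  have hV := smooth_differentiableAt (x := x) (contDiff_V0 (n := n))
  have hd := fun a => smooth_differentiableAt (x := x) (contDiff_pd hf a)
  have h1 : ∑ p, x p * (V0 x * V0 x * pd p f x * pd s f x) =
      V0 x * V0 x * pd s f x * radialDeriv f x := by
    rw [radialDeriv, Finset.mul_sum]
    exact Finset.sum_congr rfl fun p _ => by ring
  have h2 : ∑ p, x p * (V0 x * V0 x * pd j f x * pd p f x) =
      V0 x * V0 x * pd j f x * radialDeriv f x := by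
    rw [radialDeriv, Finset.mul_sum]
    exact Finset.sum_congr rfl fun p _ => by ring
  rw [covDeriv_twoTensor]
  simp only [he, h1, h2]
  rw [pd_mul l ((hV.fun_mul hV).fun_mul (hd j)) (hd s), pd_mul l (hV.fun_mul hV) (hd j),
    pd_mul l hV hV]
  ring

theorem sum_symm_mul_antisymm {R P : Fin n → Fin n → ℝ} (hR : ∀ s l, R l s = R s l)
    (hP : ∀ s l, P l s = -P s l) : ∑ s, ∑ l, R s l * P s l = 0 := by
  have h : ∑ s, ∑ l, R s l * P s l = -∑ s, ∑ l, R s l * P s l := by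
    conv_lhs => rw [Finset.sum_comm]
    rw [← Finset.sum_neg_distrib]
    refine Finset.sum_congr rfl fun s _ => ?_
    rw [← Finset.sum_neg_distrib]
    refine Finset.sum_congr rfl fun l _ => ?_
    rw [hR, hP]
    ring
  linarith

theorem massDensity_graph (k : ℕ) (hk : 1 ≤ k) {f : E n → ℝ} (hf : ContDiff ℝ ∞ f) (x : E n) :
    massDensity k (graphMetric f) V0 x = ∑ i, graphFlux k f i x * (x i / ‖x‖) := by
  have H := isHyperboloidImmersion_graph hf
  set h := secondFF (graphPosition f) (graphNormal f) x with hh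
  -- The first term is the one that `gbP_contraction` evaluates; everything in the second bracket is
  -- symmetric in `s, l`, and `gbP` is antisymmetric there.
  have hsplit : ∀ j s l, V0 x * covDeriv (hypMetric n) (twoTensor (graphMetric f - hypMetric n)) x
        ![l, j, s] - (graphMetric f - hypMetric n) x j s * pd l V0 x =
      (V0 x ^ 2 * graphFactor f x * pd s f x) * h j l +
      (V0 x ^ 3 * pd j f x * (pd l (pd s f) x + hypMetric n x l s * radialDeriv f x)
        - V0 x ^ 2 * pd s f x * pd l f x * pd j V0 x
        - V0 x ^ 5 * radialDeriv f x * pd j f x * pd l f x * pd s f x) := by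
    intro j s l
    have e := graph_secondFF hf x j l
    rw [← hh, pd_comm hf, hypMetric_symm] at e
    rw [covDeriv_twoTensor_graph hf, Pi.sub_apply, Matrix.sub_apply, graphMetric_apply]
    linear_combination (-V0 x ^ 2 * pd s f x) * e
  have hsum : ∀ i, ∑ j, ∑ s, ∑ l, (V0 x * covDeriv (hypMetric n)
        (twoTensor (graphMetric f - hypMetric n)) x ![l, j, s]
        - (graphMetric f - hypMetric n) x j s * pd l V0 x) * gbP k (graphMetric f) x i j s l =
      (1 / 2) * ∑ p, newtonT (2 * k - 1)
        (shapeOp (graphPosition f) (graphNormal f) (graphMetric f) x) i p *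
          (graphFactor f x * graphKilling f p x) := by
    intro i
    have hw : ∀ p, graphFactor f x * graphKilling f p x =
        ∑ s, (graphMetric f x)⁻¹ p s * (V0 x ^ 2 * graphFactor f x * pd s f x) := fun p => by
      rw [graphKilling, Finset.mul_sum]
      exact Finset.sum_congr rfl fun s _ => by ring
    simp only [hw]
    rw [← gbP_contraction H k hk x]
    refine Finset.sum_congr rfl fun j _ => ?_
    simp only [hsplit, add_mul, Finset.sum_add_distrib]
    rw [add_eq_left]
    refine sum_symm_mul_antisymm (fun s l => ?_) fun s l => gbP_antisymm H k hk x i j s l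
    rw [pd_comm hf s l, hypMetric_symm x s l]
    ring
  simp only [massDensity, ← Finset.sum_mul, hsum]
  refine Finset.sum_congr rfl fun i _ => ?_
  -- The factor `1/V` of the conormal turns `W` into `W/V = √det g`.
  rw [graphFlux, sqrt_graphMetric_det, conormal, ← V0_eq_sqrt]
  have e : ∑ p, newtonT (2 * k - 1)
        (shapeOp (graphPosition f) (graphNormal f) (graphMetric f) x) i p *
          (graphFactor f x * graphKilling f p x) = graphFactor f x * ∑ p, newtonT (2 * k - 1)
        (shapeOp (graphPosition f) (graphNormal f) (graphMetric f) x) i p * graphKilling f p x := by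
    rw [Finset.mul_sum]
    exact Finset.sum_congr rfl fun p _ => by ring
  rw [e]
  ring

theorem V0_mem_unitPotentials : (V0 : E n → ℝ) ∈ unitPotentials n := by
  have h0 : V0 (0 : E n) = 1 := by rw [V0_eq_sqrt]; simp
  refine ⟨⟨contDiff_V0, fun x i j => ?_⟩, V0_pos, ?_⟩
  · have hgrad : ∀ (y : E n) (I : Fin 1 → Fin n),
        covDeriv (hypMetric n) (scalarTensor V0) y I = pd (I 0) V0 y := by
      intro y I
      simp [covDeriv, scalarTensor]
    have hV := (V0_pos x).ne'
    have hs : ∀ c : ℝ, ∑ p, -c * x p * (x p / V0 x) = -c * (V0 x ^ 2 - 1) / V0 x := fun c => by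
      rw [← sum_coord_sq, Finset.mul_sum, Finset.sum_div]
      exact Finset.sum_congr rfl fun p _ => by ring
    have hcov : covDeriv (hypMetric n) (covDeriv (hypMetric n) (scalarTensor V0)) x ![i, j] =
        pd i (pd j V0) x - ∑ p, christoffel (hypMetric n) x p i j * pd p V0 x := by
      rw [covDeriv]
      simp only [hgrad]
      rw [show (∑ a : Fin (0 + 1), ∑ p, christoffel (hypMetric n) x p (![i, j] 0) (![i, j] a.succ) *
        pd (Function.update (Fin.tail ![i, j]) a p 0) V0 x) = _ from Fin.sum_univ_one _]
      simp [Fin.tail]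
    rw [hcov, pd_pd_V0]
    simp only [christoffel_hypMetric, pd_V0, hs]
    field_simp
    ring
  · simp [eta, pd_V0, h0]

end MassDensity

/-! ### Polar coordinates and the divergence theorem on Euclidean balls. -/

section DivergenceTheorem

variable {n : ℕ}

/-- `s^{n-1} ∫_{S} u(s θ, θ) dθ` over the unit sphere. -/
def radialDensity (u : E n → E n → ℝ) (s : ℝ) : ℝ :=
  s ^ (n - 1) * ∫ θ : Metric.sphere (0 : E n) 1, u (s • (θ : E n)) θ
    ∂(volume : Measure (E n)).toSphere

theorem continuous_radialDensity {u : E n → E n → ℝ} (hu : Continuous fun z : E n × E n => u z.1 z.2) :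
    Continuous (radialDensity u) := by
  refine (continuous_pow _).mul ?_
  have h : Continuous (Function.uncurry fun (s : ℝ) (θ : Metric.sphere (0 : E n) 1) =>
      u (s • (θ : E n)) θ) := by
    refine hu.comp (Continuous.prodMk ?_ ?_)
    · exact continuous_fst.smul (continuous_subtype_val.comp continuous_snd)
    · exact continuous_subtype_val.comp continuous_snd
  have := continuous_parametric_integral_of_continuous
    (μ := (volume : Measure (E n)).toSphere) h isCompact_univ
  simpa using this

/-- Integration in polar coordinates. -/
theorem integral_polar (hn : 0 < n) {u : E n → ℝ} (hu : Integrable u) :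
    IntegrableOn (radialDensity fun x _ => u x) (Set.Ioi 0) ∧
      ∫ x, u x = ∫ s in Set.Ioi 0, radialDensity (fun x _ => u x) s := by
  have : Nonempty (Fin n) := ⟨⟨0, hn⟩⟩
  have : Nontrivial (E n) := inferInstance
  have mp := (volume : Measure (E n)).measurePreserving_homeomorphUnitSphereProd
  have hdim : Module.finrank ℝ (E n) = n := by simp
  rw [hdim] at mp
  set e := homeomorphUnitSphereProd (E n) with he
  have hsymm : ∀ z : Metric.sphere (0 : E n) 1 × Set.Ioi (0 : ℝ),
      ((e.symm z : ({0}ᶜ : Set (E n))) : E n) = z.2.1 • z.1.1 := fun z => by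
    simp [he, homeomorphUnitSphereProd]
  set g : Metric.sphere (0 : E n) 1 × Set.Ioi (0 : ℝ) → ℝ := fun z => u (z.2.1 • z.1.1) with hg
  have hge : (g ∘ e) = fun x : ({0}ᶜ : Set (E n)) => u x := by
    funext x
    simp only [hg, Function.comp]
    rw [← hsymm (e x), e.symm_apply_apply]
  have hmeas : MeasurableSet ({0}ᶜ : Set (E n)) := (measurableSet_singleton 0).compl
  have hgi : Integrable g ((volume : Measure (E n)).toSphere.prod (Measure.volumeIoiPow (n - 1))) := by
    rw [← mp.integrable_comp_emb (Homeomorph.measurableEmbedding e), hge]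
    exact (integrableOn_iff_comap_subtypeVal hmeas).1 hu.integrableOn
  have hint : ∫ x, u x = ∫ z, g z ∂((volume : Measure (E n)).toSphere.prod
      (Measure.volumeIoiPow (n - 1))) := by
    rw [← mp.integral_comp (Homeomorph.measurableEmbedding e)]
    rw [show (fun x => g (e x)) = fun x : ({0}ᶜ : Set (E n)) => u x from hge,
      integral_subtype_comap hmeas, ← setIntegral_univ (μ := volume), setIntegral_congr_set]
    have : ({0}ᶜ : Set (E n)) =ᵐ[volume] Set.univ := by
      rw [ae_eq_univ]; simp
    exact this.symm
  have hmd : Measurable fun r : Set.Ioi (0 : ℝ) => ENNReal.ofReal (r.1 ^ (n - 1)) := by fun_prop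
  constructor
  · have h1 := hgi.integral_prod_right
    rw [Measure.volumeIoiPow, integrable_withDensity_iff_integrable_smul' hmd (by simp)] at h1
    rw [integrableOn_iff_comap_subtypeVal measurableSet_Ioi]
    refine h1.congr (ae_of_all _ fun r => ?_)
    simp only [smul_eq_mul, Function.comp, radialDensity, hg]
    rw [ENNReal.toReal_ofReal (pow_nonneg (le_of_lt r.2) _)]
  · rw [hint, integral_prod_symm _ hgi, Measure.volumeIoiPow,
      integral_withDensity_eq_integral_toReal_smul hmd (by simp),
      ← integral_subtype_comap measurableSet_Ioi]
    refine integral_congr_ae (ae_of_all _ fun r => ?_)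
    simp only [smul_eq_mul, radialDensity, hg]
    rw [ENNReal.toReal_ofReal (pow_nonneg (le_of_lt r.2) _)]

theorem norm_smul_sphere {r : ℝ} (hr : 0 < r) (θ : Metric.sphere (0 : E n) 1) :
    ‖r • (θ : E n)‖ = r := by
  rw [norm_smul, norm_eq_of_mem_sphere, mul_one, Real.norm_of_nonneg hr.le]

/-- The divergence of a vector field on `ℝⁿ`. -/
def euclideanDiv (Y : Fin n → E n → ℝ) (x : E n) : ℝ := ∑ i, pd i (Y i) x

theorem pd_comp_norm {φ ψ : ℝ → ℝ} (hφ : ∀ s, HasDerivAt φ (ψ s) s) {x : E n} (hx : x ≠ 0)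
    (i : Fin n) : pd i (fun y => φ ‖y‖) x = ψ ‖x‖ * (x i / ‖x‖) := by
  have hd : ∀ j, DifferentiableAt ℝ (fun y : E n => y j) x :=
    fun j => smooth_differentiableAt (contDiff_coord j)
  have hpos : 0 < ‖x‖ := norm_pos_iff.2 hx
  have h1 : ∀ y : E n, ‖y‖ = Real.sqrt (∑ j, y j * y j) := fun y => by
    rw [EuclideanSpace.norm_eq]
    congr 1
    exact Finset.sum_congr rfl fun j _ => by rw [Real.norm_eq_abs, sq_abs, sq]
  have h2 : (∑ j, x j * x j) ≠ 0 := fun h => by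
    rw [h1, h, Real.sqrt_zero] at hpos
    exact hpos.ne rfl
  have h3 : HasDerivAt (fun t => φ (Real.sqrt t)) (ψ ‖x‖ * (1 / (2 * ‖x‖))) (∑ j, x j * x j) := by
    have := (hφ ‖x‖)
    rw [h1 x] at this ⊢
    exact this.comp _ (Real.hasDerivAt_sqrt h2)
  rw [show (fun y : E n => φ ‖y‖) = fun y => φ (Real.sqrt (∑ j, y j * y j)) from
    funext fun y => by rw [h1], pd_comp (φ := fun t => φ (Real.sqrt t)) i h3
    (DifferentiableAt.fun_sum fun j _ => (hd j).fun_mul (hd j)),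
    pd_sum i fun j _ => (hd j).fun_mul (hd j)]
  simp only [pd_mul i (hd _) (hd _), pd_coord]
  have h4 : ∑ j, ((if i = j then (1 : ℝ) else 0) * x j + x j * if i = j then 1 else 0) =
      x i + x i := by simp [Finset.sum_add_distrib]
  rw [h4]
  field_simp
  ring

/-- The weak form of the divergence theorem on balls. -/
theorem integral_radial_test (hn : 0 < n) {Y : Fin n → E n → ℝ} (hY : ∀ i, ContDiff ℝ ∞ (Y i))
    {φ ψ : ℝ → ℝ} {δ M : ℝ} (hδ : 0 < δ) (hφ : ∀ s, HasDerivAt φ (ψ s) s)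
    (hψ : ContDiff ℝ ∞ ψ) (hφ0 : ∀ s < δ, φ s = φ 0) (hφM : ∀ s, M ≤ s → φ s = 0) :
    ∫ s in Set.Ioi 0, φ s * radialDensity (fun x _ => euclideanDiv Y x) s =
      -∫ s in Set.Ioi 0, ψ s * radialDensity (fun x θ => ∑ i, Y i x * θ i) s := by
  have hφs : ContDiff ℝ ∞ φ := by
    rw [contDiff_infty_iff_deriv]
    refine ⟨fun s => (hφ s).differentiableAt, ?_⟩
    rwa [show deriv φ = ψ from funext fun s => (hφ s).deriv]
  set w : E n → ℝ := fun x => φ ‖x‖ with hw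
  have hws : ContDiff ℝ ∞ w := by
    rw [contDiff_iff_contDiffAt]
    intro x
    by_cases hx : x = 0
    · subst hx
      -- The norm is not smooth at the origin, but `φ` is constant below `δ`.
      refine (contDiffAt_const (c := φ 0)).congr_of_eventuallyEq ?_
      filter_upwards [Metric.ball_mem_nhds (0 : E n) hδ] with y hy
      exact hφ0 _ (by simpa using hy)
    · exact hφs.contDiffAt.comp x (contDiffAt_norm ℝ hx)
  have hwc : HasCompactSupport w := by
    refine HasCompactSupport.of_support_subset_isCompact (isCompact_closedBall (0 : E n) M) ?_
    intro x hx
    by_contra h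
    refine hx (hφM _ ?_)
    simp at h
    exact h.le
  have hYc : ∀ i, Continuous (Y i) := fun i => (hY i).continuous
  have hpdY : ∀ i, Continuous (pd i (Y i)) := fun i => (contDiff_pd (hY i) i).continuous
  have hpdw : ∀ i, Continuous (pd i w) := fun i => (contDiff_pd hws i).continuous
  have hpdwc : ∀ i, HasCompactSupport (pd i w) := fun i =>
    (hwc.fderiv (𝕜 := ℝ)).comp_left (g := fun L : E n →L[ℝ] ℝ => L (EuclideanSpace.single i 1))
      (by simp)
  have i1 : ∀ i, Integrable fun x => w x * pd i (Y i) x := fun i =>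
    (hws.continuous.mul (hpdY i)).integrable_of_hasCompactSupport hwc.mul_right
  have i2 : ∀ i, Integrable fun x => pd i w x * Y i x := fun i =>
    ((hpdw i).mul (hYc i)).integrable_of_hasCompactSupport (hpdwc i).mul_right
  have i3 : ∀ i, Integrable fun x => w x * Y i x := fun i =>
    (hws.continuous.mul (hYc i)).integrable_of_hasCompactSupport hwc.mul_right
  -- The compact support of `w` leaves no boundary term.
  have hparts : ∀ i, ∫ x, w x * pd i (Y i) x = -∫ x, pd i w x * Y i x := fun i =>
    integral_mul_fderiv_eq_neg_fderiv_mul_of_integrable (i2 i) (i1 i) (i3 i)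
      (fun x _ => smooth_differentiableAt hws) fun x _ => smooth_differentiableAt (hY i)
  have hL := (integral_polar hn (u := fun x => ∑ i, w x * pd i (Y i) x)
    (integrable_finsetSum _ fun i _ => i1 i)).2
  have hR := (integral_polar hn (u := fun x => ∑ i, pd i w x * Y i x)
    (integrable_finsetSum _ fun i _ => i2 i)).2
  have hLR : ∫ x, ∑ i, w x * pd i (Y i) x = -∫ x, ∑ i, pd i w x * Y i x := by
    rw [integral_finsetSum _ fun i _ => i1 i, integral_finsetSum _ fun i _ => i2 i,
      ← Finset.sum_neg_distrib]
    exact Finset.sum_congr rfl fun i _ => hparts i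
  rw [hL, hR] at hLR
  have eL : ∫ s in Set.Ioi 0, radialDensity (fun x _ => ∑ i, w x * pd i (Y i) x) s =
      ∫ s in Set.Ioi 0, φ s * radialDensity (fun x _ => euclideanDiv Y x) s := by
    refine setIntegral_congr_fun measurableSet_Ioi fun s hs => ?_
    simp only [radialDensity, hw, norm_smul_sphere hs, ← Finset.mul_sum, euclideanDiv]
    rw [integral_const_mul]
    ring
  have eR : ∫ s in Set.Ioi 0, radialDensity (fun x _ => ∑ i, pd i w x * Y i x) s =
      ∫ s in Set.Ioi 0, ψ s * radialDensity (fun x θ => ∑ i, Y i x * θ i) s := by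
    refine setIntegral_congr_fun measurableSet_Ioi fun s hs => ?_
    have hs' : (0 : ℝ) < s := hs
    have e : ∀ θ : Metric.sphere (0 : E n) 1, ∑ i, pd i w (s • (θ : E n)) * Y i (s • (θ : E n)) =
        ψ s * ∑ i, Y i (s • (θ : E n)) * (θ : E n) i := fun θ => by
      have hne : s • (θ : E n) ≠ 0 := by
        rw [← norm_pos_iff, norm_smul_sphere hs']; exact hs'
      rw [Finset.mul_sum]
      refine Finset.sum_congr rfl fun i _ => ?_
      rw [hw, pd_comp_norm hφ hne, norm_smul_sphere hs']
      simp only [PiLp.smul_apply, smul_eq_mul]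
      field_simp
    simp only [radialDensity, e]
    rw [integral_const_mul]
    ring
  rw [← eL, ← eR, hLR]

/-- The divergence theorem on the balls around the origin. -/
theorem divergence_theorem_ball (hn : 0 < n) {Y : Fin n → E n → ℝ} (hY : ∀ i, ContDiff ℝ ∞ (Y i))
    {r : ℝ} (hr : 0 < r) :
    radialDensity (fun x θ => ∑ i, Y i x * θ i) r =
      ∫ s in (0 : ℝ)..r, radialDensity (fun x _ => euclideanDiv Y x) s := by
  set F := radialDensity (fun x θ => ∑ i, Y i x * θ i) with hF
  set D := radialDensity (fun x _ => euclideanDiv Y x) with hD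
  have hFc : Continuous F := continuous_radialDensity <| by
    refine continuous_finsetSum _ fun i _ => ((hY i).continuous.comp continuous_fst).mul ?_
    exact (contDiff_coord i).continuous.comp continuous_snd
  have hDc : Continuous D := continuous_radialDensity <| by
    refine continuous_finsetSum _ fun i _ => ?_
    exact (contDiff_pd (hY i) i).continuous.comp continuous_fst
  set G : ℝ → ℝ := fun r => ∫ s in (0 : ℝ)..r, D s with hG
  have hGd : ∀ s, HasDerivAt G (D s) s := fun s =>
    intervalIntegral.integral_hasDerivAt_right (hDc.intervalIntegrable _ _)
      (hDc.stronglyMeasurableAtFilter _ _) hDc.continuousAt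
  have hGc : Continuous G := continuous_iff_continuousAt.2 fun s => (hGd s).continuousAt
  -- By the fundamental lemma of the calculus of variations it suffices to test `F - G` against
  -- smooth `ψ` with compact support in `(0, ∞)`.
  have hae : ∀ᵐ s : ℝ, s ∈ Set.Ioi (0 : ℝ) → F s - G s = 0 := by
    refine isOpen_Ioi.ae_eq_zero_of_integral_contDiff_smul_eq_zero
      ((hFc.sub hGc).locallyIntegrable.locallyIntegrableOn _) fun ψ hψ hψc hψs => ?_
    obtain ⟨δ, hδ, hδs⟩ : ∃ δ > 0, ∀ s < δ, ψ s = 0 := by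
      by_cases hne : (tsupport ψ).Nonempty
      · obtain ⟨a, ha, hmin⟩ := hψc.isCompact.exists_isLeast hne
        exact ⟨a, hψs ha, fun s hs => by
          by_contra h
          exact absurd (hmin (subset_tsupport _ h)) (not_le.2 hs)⟩
      · refine ⟨1, one_pos, fun s _ => ?_⟩
        by_contra h
        exact hne ⟨s, subset_tsupport _ h⟩
    obtain ⟨M, hM⟩ : ∃ M, ∀ s, M ≤ s → ψ s = 0 := by
      obtain ⟨M, hM⟩ := hψc.isCompact.bddAbove
      refine ⟨M + 1, fun s hs => ?_⟩
      by_contra h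
      linarith [hM (subset_tsupport _ h)]
    have hM0 : 0 ≤ max M 0 := le_max_right _ _
    -- The primitive of `ψ` normalized to vanish beyond its support; since `ψ = 0` below `δ`, it is
    -- constant near `0`, as a radial test function must be.
    set φ : ℝ → ℝ := fun s => (∫ t in (0 : ℝ)..s, ψ t) - ∫ t in (0 : ℝ)..(max M 0), ψ t with hφdef
    have hφ : ∀ s, HasDerivAt φ (ψ s) s := fun s =>
      (intervalIntegral.integral_hasDerivAt_right (hψ.continuous.intervalIntegrable _ _)
        (hψ.continuous.stronglyMeasurableAtFilter _ _) hψ.continuous.continuousAt).sub_const _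
    have hφ0 : ∀ s < δ, φ s = φ 0 := fun s hs => by
      have : ∫ t in (0 : ℝ)..s, ψ t = 0 := by
        rw [intervalIntegral.integral_congr (g := fun _ => (0 : ℝ)), intervalIntegral.integral_zero]
        intro t ht
        exact hδs t (lt_of_le_of_lt ht.2 (max_lt hδ hs))
      simp [hφdef, this]
    have hφM : ∀ s, max M 0 ≤ s → φ s = 0 := fun s hs => by
      have h1 := intervalIntegral.integral_add_adjacent_intervals (μ := volume)
        (hψ.continuous.intervalIntegrable 0 (max M 0)) (hψ.continuous.intervalIntegrable (max M 0) s)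
      have h2 : ∫ t in (max M 0)..s, ψ t = 0 := by
        rw [intervalIntegral.integral_congr (g := fun _ => (0 : ℝ)), intervalIntegral.integral_zero]
        intro t ht
        rw [Set.uIcc_of_le hs] at ht
        exact hM t ((le_max_left _ _).trans ht.1)
      simp only [hφdef, ← h1, h2]
      ring
    have hweak := integral_radial_test hn hY hδ hφ hψ hφ0 hφM
    rw [← hF, ← hD] at hweak
    have hsub : Set.Ioc 0 (max M 0) ⊆ Set.Ioi (0 : ℝ) := fun s hs => hs.1
    have hres : ∀ u : ℝ → ℝ, (∀ s, max M 0 ≤ s → u s = 0) →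
        ∫ s in Set.Ioi 0, u s = ∫ s in (0 : ℝ)..(max M 0), u s := fun u hu => by
      rw [intervalIntegral.integral_of_le hM0]
      refine setIntegral_eq_of_subset_of_forall_sdiff_eq_zero measurableSet_Ioi hsub fun s hs => ?_
      refine hu s (le_of_lt ?_)
      by_contra h
      exact hs.2 ⟨hs.1, not_lt.1 h⟩
    have hψM : ∀ s, max M 0 ≤ s → ψ s = 0 := fun s hs => hM s ((le_max_left _ _).trans hs)
    -- Both boundary terms vanish, `φ` at the upper end and `G` at `0`. So `∫ φ D = -∫ ψ G`, to be
    -- compared with `∫ φ D = -∫ ψ F` from `hweak`.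
    have hparts := intervalIntegral.integral_mul_deriv_eq_deriv_mul (a := 0) (b := max M 0)
      (fun s _ => hφ s) (fun s _ => hGd s) (hψ.continuous.intervalIntegrable _ _)
      (hDc.intervalIntegrable _ _)
    have hG0 : G 0 = 0 := by simp [hG]
    rw [hφM _ le_rfl, hG0] at hparts
    rw [hres _ fun s hs => by rw [hφM s hs, zero_mul], hres _ fun s hs => by rw [hψM s hs, zero_mul],
      hparts] at hweak
    have hfin : ∫ s, ψ s • (F s - G s) = ∫ s in (0 : ℝ)..(max M 0), ψ s * (F s - G s) := by
      rw [← hres _ fun s hs => by rw [hψM s hs, zero_mul], ← setIntegral_eq_integral_of_forall_compl_eq_zero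
        (s := Set.Ioi 0)]
      · rfl
      · intro s hs
        rw [hδs s (lt_of_le_of_lt (not_lt.1 hs) hδ), zero_smul]
    rw [hfin]
    simp only [mul_sub]
    rw [intervalIntegral.integral_sub (f := fun s => ψ s * F s) (g := fun s => ψ s * G s)
      ((hψ.continuous.mul hFc).intervalIntegrable _ _)
      ((hψ.continuous.mul hGc).intervalIntegrable _ _)]
    linarith
  have heq : Set.EqOn F G (Set.Ioi 0) := by
    -- Continuity upgrades equality almost everywhere to equality at every radius.
    refine Measure.eqOn_open_of_ae_eq (μ := volume) ?_ isOpen_Ioi hFc.continuousOn hGc.continuousOn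
    rw [EventuallyEq, ae_restrict_iff' measurableSet_Ioi]
    filter_upwards [hae] with s hs hs'
    exact sub_eq_zero.1 (hs hs')
  exact heq hr

end DivergenceTheorem

/-! ### From the flux identity to the mass formula. -/

section MassFormula

variable {n : ℕ} {f : E n → ℝ}

theorem contDiff_gbCurv_graph (k : ℕ) (hf : ContDiff ℝ ∞ f) :
    ContDiff ℝ ∞ (gbCurv k (graphMetric f)) := by
  have H := isHyperboloidImmersion_graph hf
  rw [funext fun x => gbCurv_eq_newtonS H k x]
  exact contDiff_newtonS _ H.smooth_shapeOp

/-- The geodesic sphere of radius `r` is the coordinate sphere of radius `sinh r`, with the same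
area element, so the flux is the Euclidean flux of `graphFlux`. -/
theorem massFlux_graph (hn : 0 < n) {k : ℕ} (hk : 1 ≤ k) (hf : ContDiff ℝ ∞ f) {r : ℝ}
    (hr : 0 < r) : massFlux k (graphMetric f) V0 r =
      ∫ s in (0 : ℝ)..Real.sinh r,
        radialDensity (fun x _ => (1 / 2) * gbCurv k (graphMetric f) x) s := by
  have hs : 0 < Real.sinh r := Real.sinh_pos_iff.2 hr
  have hdiv := divergence_theorem_ball hn (contDiff_graphFlux k hf) hs
  simp only [euclideanDiv, graphFlux_divergence k hk hf] at hdiv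
  rw [← hdiv, massFlux, radialDensity, integral_mul_const, mul_comm]
  congr 1
  refine integral_congr_ae (ae_of_all _ fun θ => ?_)
  simp only [massDensity_graph k hk hf, norm_smul_sphere hs]
  refine Finset.sum_congr rfl fun i _ => ?_
  simp only [PiLp.smul_apply, smul_eq_mul]
  field_simp

theorem graphFactor_ge_one (f : E n → ℝ) (x : E n) : 1 ≤ graphFactor f x := by
  rw [graphFactor, Real.one_le_sqrt]
  have := gradSq_nonneg f x
  have : 0 ≤ V0 x ^ 2 * gradSq f x := by positivity
  linarith

theorem measurable_volDensity (hf : ContDiff ℝ ∞ f) :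
    Measurable fun x => ENNReal.ofReal (Real.sqrt (graphMetric f x).det) :=
  (contDiff_matrix_det (isHyperboloidImmersion_graph hf).smooth_metric).continuous.sqrt.measurable.ennreal_ofReal

theorem toReal_volDensity (f : E n → ℝ) (x : E n) :
    (ENNReal.ofReal (Real.sqrt (graphMetric f x).det)).toReal = graphFactor f x / V0 x := by
  rw [ENNReal.toReal_ofReal (Real.sqrt_nonneg _), sqrt_graphMetric_det]

theorem volDensity_smul_massIntegrand (k : ℕ) (f : E n → ℝ) (x : E n) :
    (ENNReal.ofReal (Real.sqrt (graphMetric f x).det)).toReal • massIntegrand k f x =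
      (1 / 2) * gbCurv k (graphMetric f) x := by
  rw [toReal_volDensity, smul_eq_mul, massIntegrand,
    show Real.sqrt (1 + V0 x ^ 2 * gradSq f x) = graphFactor f x from rfl]
  have := (V0_pos x).ne'
  have := (graphFactor_pos f x).ne'
  field_simp

/-- In the chart `V L̃_k dV_g` is `W L̃_k dx`, which dominates `L̃_k dx` because `W ≥ 1`. -/
theorem integrable_gbCurv {k : ℕ} (hf : ContDiff ℝ ∞ f)
    (hint : Integrable (fun x => V0 x * gbCurv k (graphMetric f) x) (volMeasure (graphMetric f))) :
    Integrable (gbCurv k (graphMetric f)) := by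
  rw [volMeasure, integrable_withDensity_iff_integrable_smul' (measurable_volDensity hf)
    (ae_of_all _ fun x => ENNReal.ofReal_lt_top)] at hint
  refine hint.mono (contDiff_gbCurv_graph k hf).continuous.aestronglyMeasurable
    (ae_of_all _ fun x => ?_)
  have hV := V0_pos x
  rw [toReal_volDensity, smul_eq_mul, show graphFactor f x / V0 x * (V0 x *
    gbCurv k (graphMetric f) x) = graphFactor f x * gbCurv k (graphMetric f) x by field_simp,
    norm_mul]
  refine le_mul_of_one_le_left (norm_nonneg _) ?_
  rw [Real.norm_of_nonneg (graphFactor_pos f x).le]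
  exact graphFactor_ge_one f x

theorem integrable_massIntegrand {k : ℕ} (hf : ContDiff ℝ ∞ f)
    (hL : Integrable (gbCurv k (graphMetric f))) :
    Integrable (massIntegrand k f) (volMeasure (graphMetric f)) := by
  rw [volMeasure, integrable_withDensity_iff_integrable_smul' (measurable_volDensity hf)
    (ae_of_all _ fun x => ENNReal.ofReal_lt_top)]
  simp only [volDensity_smul_massIntegrand]
  exact hL.const_mul _

theorem integral_massIntegrand (k : ℕ) (hf : ContDiff ℝ ∞ f) :
    ∫ x, massIntegrand k f x ∂(volMeasure (graphMetric f)) =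
      ∫ x, (1 / 2) * gbCurv k (graphMetric f) x := by
  rw [volMeasure, integral_withDensity_eq_integral_toReal_smul (measurable_volDensity hf)
    (ae_of_all _ fun x => ENNReal.ofReal_lt_top)]
  simp only [volDensity_smul_massIntegrand]

/-- Polar coordinates make the integral over balls an improper radial integral, and `sinh r → ∞`. -/
theorem tendsto_massFlux (hn : 0 < n) {k : ℕ} (hk : 1 ≤ k) (hf : ContDiff ℝ ∞ f)
    (hL : Integrable (gbCurv k (graphMetric f))) :
    Tendsto (massFlux k (graphMetric f) V0) atTop
      (𝓝 (∫ x, massIntegrand k f x ∂(volMeasure (graphMetric f)))) := by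
  obtain ⟨h1, h2⟩ := integral_polar hn (hL.const_mul (1 / 2))
  rw [integral_massIntegrand k hf, h2]
  have hsinh : Tendsto Real.sinh atTop atTop :=
    Real.sinhOrderIso.tendsto_atTop
  refine (intervalIntegral_tendsto_integral_Ioi 0 h1 hsinh).congr' ?_
  filter_upwards [eventually_gt_atTop 0] with r hr
  rw [massFlux_graph hn hk hf hr]

theorem massConst_nonneg (n k : ℕ) : 0 ≤ massConst n k := by
  rw [massConst, sphereArea]
  positivity

end MassFormula
end GBCMass

end

/-! ### The positive mass theorem for graphs. -/

theorem theorem1p3 (n k : ℕ) (hk : 2 ≤ k) (hkn : 2 * k < n) (τ : ℝ) (hτ : (n : ℝ) / (k + 1) < τ)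
    (f : GBCMass.E n → ℝ) (hf : ContDiff ℝ ∞ f)
    (hAH : GBCMass.IsAsymptoticallyHyperbolic (GBCMass.graphMetric f) τ)
    (hint : Integrable (fun x => GBCMass.V0 x * GBCMass.gbCurv k (GBCMass.graphMetric f) x)
      (GBCMass.volMeasure (GBCMass.graphMetric f))) :
    -- the limit defining `H_k(V)` exists, the integral converges, and the mass formula holds
    Integrable (GBCMass.massIntegrand k f) (GBCMass.volMeasure (GBCMass.graphMetric f)) ∧
    Tendsto (GBCMass.massFlux k (GBCMass.graphMetric f) GBCMass.V0) atTop
      (𝓝 (GBCMass.massFunctional k (GBCMass.graphMetric f) GBCMass.V0)) ∧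
    GBCMass.massConst n k * GBCMass.massFunctional k (GBCMass.graphMetric f) GBCMass.V0 =
      GBCMass.massConst n k *
        ∫ x, GBCMass.massIntegrand k f x ∂(GBCMass.volMeasure (GBCMass.graphMetric f)) ∧
    ((∀ x, 0 ≤ GBCMass.gbCurv k (GBCMass.graphMetric f) x) →
      0 ≤ GBCMass.massConst n k *
        GBCMass.massFunctional k (GBCMass.graphMetric f) GBCMass.V0) ∧
    -- hence for the infimum mass, under the normalization that `V = cosh r` attains the infimum
    ((∀ W ∈ GBCMass.unitPotentials n,
        GBCMass.massFunctional k (GBCMass.graphMetric f) GBCMass.V0 ≤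
          GBCMass.massFunctional k (GBCMass.graphMetric f) W) →
      GBCMass.gbcMass k (GBCMass.graphMetric f) =
        GBCMass.massConst n k *
          ∫ x, GBCMass.massIntegrand k f x ∂(GBCMass.volMeasure (GBCMass.graphMetric f)) ∧
      ((∀ x, 0 ≤ GBCMass.gbCurv k (GBCMass.graphMetric f) x) →
        0 ≤ GBCMass.gbcMass k (GBCMass.graphMetric f))) := by
  have hL := GBCMass.integrable_gbCurv hf hint
  have hlim := GBCMass.tendsto_massFlux (by omega) (by omega) hf hL
  have hH : GBCMass.massFunctional k (GBCMass.graphMetric f) GBCMass.V0 =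
      ∫ x, GBCMass.massIntegrand k f x ∂(GBCMass.volMeasure (GBCMass.graphMetric f)) :=
    hlim.limUnder_eq
  have hnonneg : (∀ x, 0 ≤ GBCMass.gbCurv k (GBCMass.graphMetric f) x) →
      0 ≤ GBCMass.massConst n k *
        GBCMass.massFunctional k (GBCMass.graphMetric f) GBCMass.V0 := fun h0 => by
    rw [hH, GBCMass.integral_massIntegrand k hf]
    exact mul_nonneg (GBCMass.massConst_nonneg n k)
      (integral_nonneg fun x => mul_nonneg (by norm_num) (h0 x))
  refine ⟨GBCMass.integrable_massIntegrand hf hL, hH ▸ hlim, by rw [hH], hnonneg, fun hmin => ?_⟩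
  have hmass : GBCMass.gbcMass k (GBCMass.graphMetric f) = GBCMass.massConst n k *
      GBCMass.massFunctional k (GBCMass.graphMetric f) GBCMass.V0 := by
    -- A least element makes `sInf` the true infimum, independently of its default values; `V` is in
    -- the set by `V0_mem_unitPotentials`.
    have hleast : IsLeast (GBCMass.massFunctional k (GBCMass.graphMetric f) ''
        GBCMass.unitPotentials n)
        (GBCMass.massFunctional k (GBCMass.graphMetric f) GBCMass.V0) :=
      ⟨⟨_, GBCMass.V0_mem_unitPotentials, rfl⟩, by rintro _ ⟨W, hW, rfl⟩; exact hmin W hW⟩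
    rw [GBCMass.gbcMass, hleast.csInf_eq]
  exact ⟨by rw [hmass, hH], fun h0 => hmass ▸ hnonneg h0⟩
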